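/- Let $(M,g,J)$ be a connected almost Hermitian six-manifold: $M$ is a connected smooth manifold of dimension six, $g$ is a smooth Riemannian metric, and $J$ is a smooth almost complex structure with $g(J\cdot,J\cdot)=g$. Let $\nabla$ be the Levi-Civita connection of $g$ and let $\sigma=g(J\cdot,\cdot)$ be the fundamental two-form. Call $M$ (strict) nearly Kähler if $(\nabla_XJ)X=0$ for every smooth vector field $X$ and $\nabla J\not\equiv 0$. Then $M$ is nearly Kähler if and only if there exist a real constant $\mu\neq 0$ and a smooth complex $(3,0)$-form $\psi_{\mathbb C}=\psi_++i\psi_-$ on $M$ such that $$d\sigma=3\mu\,\psi_+,\qquad d\psi_-=-2\mu\,\sigma\wedge\sigma .$$ Moreover, whenever $\mu\neq0$ and a smooth $(3,0)$-form $\psi_{\mathbb C}$ satisfy these equations, $(\sigma,\psi_{\mathbb C})$ is an $\mathrm{SU}(3)$-structure: every tangent space has an orthonormal basis $e_1,Je_1,e_2,Je_2,e_3,Je_3$ with $\psi_{\mathbb C}(e_1,e_2,e_3)=1$. -/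

import Mathlib

open Bundle
open scoped Manifold ContDiff

/-- Linear algebra behind Koszul's formula: raising an index with a positive definite form. -/
theorem exists_raise {E : Type*} [NormedAddCommGroup E] [NormedSpace ℝ E] [FiniteDimensional ℝ E]
    (b : E →L[ℝ] E →L[ℝ] ℝ) (hb : ∀ v, v ≠ 0 → 0 < b v v) (D : E →L[ℝ] E →L[ℝ] E →L[ℝ] ℝ) :
    ∃ B : E →L[ℝ] E →L[ℝ] E, ∀ u v w, b (B u v) w = 2⁻¹ * (D u w v + D v w u - D u v w) := by
  have hinj : Function.Injective (b : E →ₗ[ℝ] E →L[ℝ] ℝ) := by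
    rw [← LinearMap.ker_eq_bot, LinearMap.ker_eq_bot']
    intro v hv
    by_contra h
    have h1 := hb v h
    have h2 : b v v = 0 := congr($hv v)
    linarith
  have hdim : Module.finrank ℝ E = Module.finrank ℝ (E →L[ℝ] ℝ) := by
    rw [← (LinearMap.toContinuousLinearMap (𝕜 := ℝ) (E := E) (F' := ℝ)).finrank_eq]
    exact (Subspace.dual_finrank_eq).symm
  let e := LinearMap.linearEquivOfInjective _ hinj hdim
  have he : ∀ φ w, b (e.symm φ) w = φ w := fun φ w ↦ congr($(e.apply_symm_apply φ) w)
  have a1 : ∀ u u' v w, D (u + u') v w = D u v w + D u' v w := fun _ _ _ _ ↦ by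
    rw [D.map_add]; rfl
  have a2 : ∀ u v v' w, D u (v + v') w = D u v w + D u v' w := fun u _ _ _ ↦ by
    rw [(D u).map_add]; rfl
  have a3 : ∀ u v w w', D u v (w + w') = D u v w + D u v w' := fun u v _ _ ↦ (D u v).map_add _ _
  have s1 : ∀ (c : ℝ) u v w, D (c • u) v w = c * D u v w := fun _ _ _ _ ↦ by
    rw [D.map_smul]; rfl
  have s2 : ∀ (c : ℝ) u v w, D u (c • v) w = c * D u v w := fun _ u _ _ ↦ by
    rw [(D u).map_smul]; rfl
  have s3 : ∀ (c : ℝ) u v w, D u v (c • w) = c * D u v w := fun c u v _ ↦ (D u v).map_smul c _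
  let φ (u v : E) : E →L[ℝ] ℝ := LinearMap.toContinuousLinearMap
    { toFun := fun w ↦ 2⁻¹ * (D u w v + D v w u - D u v w)
      map_add' := fun w w' ↦ by rw [a2, a2, a3]; ring
      map_smul' := fun c w ↦ by rw [s2, s2, s3, smul_eq_mul, RingHom.id_apply]; ring }
  have hφ : ∀ u v w, φ u v w = 2⁻¹ * (D u w v + D v w u - D u v w) := fun _ _ _ ↦ rfl
  let L : E →ₗ[ℝ] E →ₗ[ℝ] E := LinearMap.mk₂ ℝ (fun u v ↦ e.symm (φ u v))
    (fun u u' v ↦ by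
      rw [← map_add]; congr 1; ext w
      rw [add_apply, hφ, hφ, hφ, a1, a1, a3]; ring)
    (fun c u v ↦ by
      rw [← map_smul]; congr 1; ext w
      rw [smul_apply, hφ, hφ, s1, s1, s3, smul_eq_mul]; ring)
    (fun u v v' ↦ by
      rw [← map_add]; congr 1; ext w
      rw [add_apply, hφ, hφ, hφ, a1, a2, a3]; ring)
    (fun c u v ↦ by
      rw [← map_smul]; congr 1; ext w
      rw [smul_apply, hφ, hφ, s1, s2, s3, smul_eq_mul]; ring)
  refine ⟨L.toContinuousBilinearMap, fun u v w ↦ ?_⟩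
  rw [LinearMap.toContinuousBilinearMap_apply, LinearMap.mk₂_apply, he, hφ]

section LeviCivita

variable {E : Type*} [NormedAddCommGroup E] [NormedSpace ℝ E]
  {H : Type*} [TopologicalSpace H] {I : ModelWithCorners ℝ E H}
  {M : Type*} [TopologicalSpace M] [ChartedSpace H M] [IsManifold I ∞ M]

/-- The tangent bundle carries some connection: at `x`, differentiate in the trivialization
centred at `x`. -/
theorem exists_connection :
    Nonempty (CovariantDerivative I E (TangentSpace I : M → Type _)) := by
  let t (x : M) := trivializationAt E (TangentSpace I : M → Type _) x
  let c (Y : Π x : M, TangentSpace I x) (x : M) : M → E :=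
    fun y ↦ (t x).continuousLinearMapAt ℝ y (Y y)
  have hx : ∀ x, x ∈ (t x).baseSet := fun x ↦ FiberBundle.mem_baseSet_trivializationAt' x
  have hd : ∀ {Y : Π x : M, TangentSpace I x} {x : M}, MDiffAt (T% Y) x →
      MDiffAt (c Y x) x := by
    intro Y x hY
    refine ((mdifferentiableAt_section I Y).1 hY).congr_of_eventuallyEq ?_
    filter_upwards [(t x).open_baseSet.mem_nhds (hx x)] with y hy
    exact congrFun ((t x).coe_linearMapAt_of_mem hy) (Y y)
  refine ⟨⟨fun Y x ↦ ((t x).symmL ℝ x).comp (mvfderiv I (c Y x) x), ?_, ?_⟩⟩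
  · intro Y Y' x hY hY' _
    have h : c (Y + Y') x = c Y x + c Y' x := by
      funext y
      simp [c]
    rw [h, mvfderiv_add (hd hY) (hd hY'), ContinuousLinearMap.comp_add]
  · intro Y f x hY hf _
    have h : c (f • Y) x = f • c Y x := by
      funext y
      simp [c]
    rw [h, mvfderiv_smul hf (hd hY)]
    ext v
    have h0 := (t x).symmL_continuousLinearMapAt (R := ℝ) (hx x) (Y x)
    simp only [Bundle.Trivialization.continuousLinearMapAt_apply] at h0
    simp [c, h0]

variable (g : ContMDiffRiemannianMetric I ∞ E (fun x : M ↦ TangentSpace I x))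

theorem mdifferentiableAt_inner {Y Z : Π x : M, TangentSpace I x} {x : M}
    (hY : MDiffAt (T% Y) x) (hZ : MDiffAt (T% Z) x) :
    MDiffAt (fun y ↦ g.inner y (Y y) (Z y)) x := by
  have h : MDifferentiableAt I (I.prod 𝓘(ℝ, ℝ))
      (fun m ↦ TotalSpace.mk' ℝ (E := Bundle.Trivial M ℝ) m (g.inner m (Y m) (Z m))) x :=
    MDifferentiableAt.clm_bundle_apply₂ (F₁ := E) (F₂ := E)
      (g.contMDiff.mdifferentiableAt (by simp)) hY hZ
  simp only [mdifferentiableAt_totalSpace] at h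
  exact h.2

variable [FiniteDimensional ℝ E]

/-- `cov` is a Levi-Civita connection of `g`: it is metric, `X g(Y, Z) = g(∇_X Y, Z) + g(Y, ∇_X Z)`,
and torsion free. (In Mathlib, `cov Y x (X x)` is the value of `∇_X Y` at `x`.) -/
def IsLeviCivita (cov : CovariantDerivative I E (TangentSpace I : M → Type _)) : Prop :=
  (∀ (X Y Z : Π x : M, TangentSpace I x) (x : M), MDiffAt (T% Y) x → MDiffAt (T% Z) x →
    mvfderiv I (fun y ↦ g.inner y (Y y) (Z y)) x (X x) =
      g.inner x (cov Y x (X x)) (Z x) + g.inner x (Y x) (cov Z x (X x))) ∧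
  cov.torsion = 0

/-- The difference between the two sides of the metric condition is a tensor. -/
theorem exists_metricDefect (c : CovariantDerivative I E (TangentSpace I : M → Type _)) (x : M) :
    ∃ D : TangentSpace I x →L[ℝ] TangentSpace I x →L[ℝ] TangentSpace I x →L[ℝ] ℝ,
      (∀ u v w, D u v w = D v u w) ∧
      ∀ Y Z : Π x : M, TangentSpace I x, MDiffAt (T% Y) x → MDiffAt (T% Z) x →
        ∀ u : TangentSpace I x, D (Y x) (Z x) u = mvfderiv I (fun y ↦ g.inner y (Y y) (Z y)) x u
          - g.inner x (c Y x u) (Z x) - g.inner x (Y x) (c Z x u) := by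
  let Φ (Y Z : Π x : M, TangentSpace I x) : TangentSpace I x →L[ℝ] ℝ :=
    mvfderiv I (fun y ↦ g.inner y (Y y) (Z y)) x
      - (g.inner x (Z x)).comp (c Y x) - (g.inner x (Y x)).comp (c Z x)
  have hs : ∀ Y Z, Φ Y Z = Φ Z Y := by
    intro Y Z
    have : (fun y ↦ g.inner y (Y y) (Z y)) = fun y ↦ g.inner y (Z y) (Y y) :=
      funext fun y ↦ g.symm y _ _
    simp only [Φ, this]
    abel
  have ht : ∀ Z, MDiffAt (T% Z) x → TensorialAt I E (Φ · Z) x := by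
    intro Z hZ
    refine ⟨fun {f Y} hf hY ↦ ?_, fun {Y Y'} hY hY' ↦ ?_⟩
    · ext u
      have h : (fun y ↦ g.inner y ((f • Y) y) (Z y)) = f • fun y ↦ g.inner y (Y y) (Z y) := by
        funext y; simp
      simp only [Φ, h]
      rw [mvfderiv_smul hf (mdifferentiableAt_inner g hY hZ),
        c.isCovariantDerivativeOn.leibniz hY hf]
      simp [g.symm x (Z x) (Y x)]
      ring
    · ext u
      have h : (fun y ↦ g.inner y ((Y + Y') y) (Z y)) =
          (fun y ↦ g.inner y (Y y) (Z y)) + fun y ↦ g.inner y (Y' y) (Z y) := by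
        funext y; simp
      simp only [Φ, h]
      rw [mvfderiv_add (mdifferentiableAt_inner g hY hZ) (mdifferentiableAt_inner g hY' hZ),
        c.isCovariantDerivativeOn.add hY hY']
      simp
      ring
  have ht' : ∀ Y, MDiffAt (T% Y) x → TensorialAt I E (Φ Y ·) x := by
    intro Y hY
    simpa only [hs Y] using ht Y hY
  let D := TensorialAt.mkHom₂ (Φ · ·) x ht ht'
  refine ⟨D, fun u v w ↦ ?_, fun Y Z hY hZ u ↦ ?_⟩
  · simp only [D, TensorialAt.mkHom₂_apply_eq_extend, hs (FiberBundle.extend E u)]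
  · simp only [D]
    rw [TensorialAt.mkHom₂_apply _ _ hY hZ]
    simp [Φ, g.symm x (Z x)]

/-- Existence of the Levi-Civita connection: remove the torsion of an arbitrary connection, then
correct by the symmetric tensor that makes it metric. -/
theorem exists_isLeviCivita :
    ∃ cov : CovariantDerivative I E (TangentSpace I : M → Type _), IsLeviCivita g cov := by
  obtain ⟨c₀⟩ := exists_connection (I := I) (M := M)
  obtain ⟨c, hc⟩ : ∃ c : CovariantDerivative I E (TangentSpace I : M → Type _),
      c.torsion = 0 := by
    refine ⟨c₀.addOneForm fun x ↦ (2⁻¹ : ℝ) • c₀.torsion x, ?_⟩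
    rw [CovariantDerivative.torsion_eq_zero_iff]
    intro X Y x hX hY
    have h := c₀.torsion_apply hX hY
    have h' := c₀.torsion_antisymm (Y x) (X x)
    change c₀ Y x (X x) + (2⁻¹ : ℝ) • c₀.torsion x (Y x) (X x) -
      (c₀ X x (Y x) + (2⁻¹ : ℝ) • c₀.torsion x (X x) (Y x)) = _
    rw [h', h]
    module
  rw [CovariantDerivative.torsion_eq_zero_iff] at hc
  choose D hDs hD using exists_metricDefect g c
  have hB : ∀ x : M, ∃ B : TangentSpace I x →L[ℝ] TangentSpace I x →L[ℝ] TangentSpace I x,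
      ∀ u v w, g.inner x (B u v) w = 2⁻¹ * (D x u w v + D x v w u - D x u v w) := by
    intro x
    exact exists_raise (E := E) (g.inner x) (g.pos x) (D x)
  choose B hB using hB
  refine ⟨c.addOneForm B, fun X Y Z x hY hZ ↦ ?_, ?_⟩
  · have h := hD x Y Z hY hZ (X x)
    have h1 := hB x (Y x) (X x) (Z x)
    have h2 := hB x (Z x) (X x) (Y x)
    have e1 := hDs x (X x) (Z x) (Y x)
    have e2 := hDs x (X x) (Y x) (Z x)
    have e3 := hDs x (Y x) (Z x) (X x)
    have h3 := g.symm x (B x (Z x) (X x)) (Y x)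
    change _ = g.inner x (c Y x (X x) + B x (Y x) (X x)) (Z x) +
      g.inner x (Y x) (c Z x (X x) + B x (Z x) (X x))
    simp only [map_add, add_apply]
    linarith
  · rw [CovariantDerivative.torsion_eq_zero_iff]
    intro X Y x hX hY
    have h : B x (Y x) (X x) = B x (X x) (Y x) := by
      by_contra hne
      have hp := g.pos x _ (sub_ne_zero.2 hne)
      have h0 : ∀ w, g.inner x (B x (Y x) (X x) - B x (X x) (Y x)) w = 0 := by
        intro w
        have e1 := hB x (Y x) (X x) w
        have e2 := hB x (X x) (Y x) w
        have e3 := hDs x (X x) (Y x) w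
        simp only [map_sub, sub_apply]
        linarith
      exact hp.ne' (h0 _)
    change c Y x (X x) + B x (Y x) (X x) - (c X x (Y x) + B x (X x) (Y x)) = _
    rw [h, ← hc hX hY]
    abel

/-- The Levi-Civita connection of `g`. -/
noncomputable def leviCivita : CovariantDerivative I E (TangentSpace I : M → Type _) :=
  (exists_isLeviCivita g).choose

theorem isLeviCivita_leviCivita : IsLeviCivita g (leviCivita g) :=
  (exists_isLeviCivita g).choose_spec

end LeviCivita

section AlmostHermitian

variable {n : ℕ} {M : Type*} [TopologicalSpace M] [ChartedSpace (EuclideanSpace ℝ (Fin n)) M]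

/-- An almost Hermitian structure on a smooth `n`-manifold `M`: a smooth Riemannian metric `g` and
a smooth almost complex structure `J` which is orthogonal for `g`. -/
structure AlmostHermitian (n : ℕ) (M : Type*) [TopologicalSpace M]
    [ChartedSpace (EuclideanSpace ℝ (Fin n)) M] [IsManifold (𝓡 n) ∞ M] where
  /-- The Riemannian metric. -/
  g : ContMDiffRiemannianMetric (𝓡 n) ∞ (EuclideanSpace ℝ (Fin n))
    (fun x : M ↦ TangentSpace (𝓡 n) x)
  /-- The almost complex structure. -/
  J : Π x : M, TangentSpace (𝓡 n) x →L[ℝ] TangentSpace (𝓡 n) x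
  contMDiff_J : ContMDiff (𝓡 n)
    ((𝓡 n).prod 𝓘(ℝ, EuclideanSpace ℝ (Fin n) →L[ℝ] EuclideanSpace ℝ (Fin n))) ∞
    (fun x ↦ TotalSpace.mk' (EuclideanSpace ℝ (Fin n) →L[ℝ] EuclideanSpace ℝ (Fin n))
      (E := fun x : M ↦ TangentSpace (𝓡 n) x →L[ℝ] TangentSpace (𝓡 n) x) x (J x))
  J_J : ∀ (x : M) (v : TangentSpace (𝓡 n) x), J x (J x v) = -v
  g_J_J : ∀ (x : M) (v w : TangentSpace (𝓡 n) x), g.inner x (J x v) (J x w) = g.inner x v w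

/-- A (not necessarily smooth) `F`-valued differential `k`-form on `M`. -/
abbrev DForm (n : ℕ) (M : Type*) [TopologicalSpace M] [ChartedSpace (EuclideanSpace ℝ (Fin n)) M]
    (k : ℕ) (F : Type*) [NormedAddCommGroup F] [NormedSpace ℝ F] :=
  Π x : M, TangentSpace (𝓡 n) x [⋀^Fin k]→L[ℝ] F

namespace DForm

variable {k : ℕ} {F : Type*} [NormedAddCommGroup F] [NormedSpace ℝ F]

/-- The expression of a form in the preferred chart at `x₀`: the pullback by the inverse chart. -/
noncomputable def inChart (α : DForm n M k F) (x₀ : M) (u : EuclideanSpace ℝ (Fin n)) :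
    EuclideanSpace ℝ (Fin n) [⋀^Fin k]→L[ℝ] F :=
  (α ((extChartAt (𝓡 n) x₀).symm u)).compContinuousLinearMap
    (mfderiv 𝓘(ℝ, EuclideanSpace ℝ (Fin n)) (𝓡 n) (extChartAt (𝓡 n) x₀).symm u)

/-- A form is smooth if its expressions in charts are. -/
def IsSmooth (α : DForm n M k F) : Prop :=
  ∀ x₀ : M, ContDiffOn ℝ ∞ (α.inChart x₀) (extChartAt (𝓡 n) x₀).target

/-- The exterior derivative, computed at `x` in the preferred chart at `x`. -/
noncomputable def d (α : DForm n M k F) : DForm n M (k + 1) F := fun x ↦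
  (extDeriv (α.inChart x) (extChartAt (𝓡 n) x x)).compContinuousLinearMap
    (mfderiv (𝓡 n) 𝓘(ℝ, EuclideanSpace ℝ (Fin n)) (extChartAt (𝓡 n) x) x)

/-- The real part `ψ₊` of a complex form. -/
noncomputable def re (ψ : DForm n M k ℂ) : DForm n M k ℝ := fun x ↦
  Complex.reCLM.compContinuousAlternatingMap (ψ x)

/-- The imaginary part `ψ₋` of a complex form. -/
noncomputable def im (ψ : DForm n M k ℂ) : DForm n M k ℝ := fun x ↦
  Complex.imCLM.compContinuousAlternatingMap (ψ x)

/-- The wedge product of real forms,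
`(α ∧ β)(v) = ∑ sign(s) α(v_{s(1)}, …, v_{s(k)}) β(v_{s(k+1)}, …, v_{s(k+l)})`, the sum being over
the `(k, l)`-shuffles `s`. -/
noncomputable def wedge {l : ℕ} (α : DForm n M k ℝ) (β : DForm n M l ℝ) : DForm n M (k + l) ℝ :=
  fun x ↦
  { ((LinearMap.mul' ℝ ℝ).compAlternatingMap
      ((α x).toAlternatingMap.domCoprod (β x).toAlternatingMap)).domDomCongr finSumFinEquiv with
    cont := by
      change Continuous fun v : Fin (k + l) → TangentSpace (𝓡 n) x ↦ LinearMap.mul' ℝ ℝ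
        ((α x).toAlternatingMap.domCoprod (β x).toAlternatingMap fun i ↦ v (finSumFinEquiv i))
      simp only [AlternatingMap.domCoprod_apply, sum_apply, map_sum]
      refine continuous_finsetSum _ fun s _ ↦ ?_
      induction s using Quotient.inductionOn' with
      | h s =>
        change Continuous fun v : Fin (k + l) → TangentSpace (𝓡 n) x ↦ LinearMap.mul' ℝ ℝ
          ((Equiv.Perm.sign s : ℤ) • TensorProduct.tmul ℝ
            (α x fun i ↦ v (finSumFinEquiv (s (.inl i))))
            (β x fun i ↦ v (finSumFinEquiv (s (.inr i)))))
        simp only [map_zsmul, LinearMap.mul'_apply]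
        refine ((Continuous.mul ((α x).cont.comp ?_) ((β x).cont.comp ?_))).zsmul _ <;>
        exact continuous_pi fun i ↦ continuous_apply _ }

end DForm

variable [IsManifold (𝓡 n) ∞ M]

namespace AlmostHermitian

variable (S : AlmostHermitian n M)

/-- The fundamental two-form `σ = g(J·, ·)`. -/
noncomputable def σ : DForm n M 2 ℝ := fun x ↦
  { toFun := fun v ↦ S.g.inner x (S.J x (v 0)) (v 1)
    map_update_add' := by
      intro _ v i a b
      fin_cases i <;> simp
    map_update_smul' := by
      intro _ v i c a
      fin_cases i <;> simp
    map_eq_zero_of_eq' := by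
      have h0 : ∀ v, S.g.inner x (S.J x v) v = 0 := by
        intro v
        have h1 := S.g_J_J x (S.J x v) v
        have h2 := S.g.symm x v (S.J x v)
        rw [S.J_J] at h1
        simp only [map_neg, neg_apply] at h1
        linarith
      intro v i j hv hij
      fin_cases i <;> fin_cases j <;> simp_all
    cont := by
      have h := (ContinuousLinearMap.isBoundedBilinearMap (𝕜 := ℝ) (E := EuclideanSpace ℝ (Fin n))
        (F := EuclideanSpace ℝ (Fin n)) (G := ℝ) (S.g.inner x)).continuous
      exact h.comp (((S.J x).continuous.comp (continuous_apply 0)).prodMk (continuous_apply 1)) }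

/-- `(∇_X J) Y = ∇_X (J Y) - J ∇_X Y`, for the Levi-Civita connection `∇` of `g`. -/
noncomputable def nablaJ (X Y : Π x : M, TangentSpace (𝓡 n) x) (x : M) : TangentSpace (𝓡 n) x :=
  leviCivita S.g (fun y ↦ S.J y (Y y)) x (X x) - S.J x (leviCivita S.g Y x (X x))

/-- Smooth vector fields on `M`. -/
def _root_.IsSmoothVectorField (X : Π x : M, TangentSpace (𝓡 n) x) : Prop :=
  ContMDiff (𝓡 n) (𝓡 n).tangent ∞ (fun x ↦ (⟨x, X x⟩ : TangentBundle (𝓡 n) M))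

/-- (Strict) nearly Kähler: `(∇_X J) X = 0` for every smooth vector field `X`, and `∇ J` is not
identically zero. -/
def IsNearlyKahler : Prop :=
  (∀ X : Π x : M, TangentSpace (𝓡 n) x, IsSmoothVectorField X → ∀ x, S.nablaJ X X x = 0) ∧
  ∃ X Y : Π x : M, TangentSpace (𝓡 n) x, IsSmoothVectorField X ∧ IsSmoothVectorField Y ∧
    ∃ x, S.nablaJ X Y x ≠ 0

/-- A complex three-form is of type `(3, 0)` if it vanishes as soon as one argument is of type
`(0, 1)`, i.e. of the form `u + i J u`. -/
def IsType30 (ψ : DForm n M 3 ℂ) : Prop :=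
  ∀ (x : M) (u v w : TangentSpace (𝓡 n) x),
    ψ x ![u, v, w] + Complex.I * ψ x ![S.J x u, v, w] = 0

/-- `(σ, ψ)` is an `SU(3)`-structure: `ψ` is of type `(3, 0)` and every tangent space has an
orthonormal basis `e₁, J e₁, e₂, J e₂, e₃, J e₃` with `ψ(e₁, e₂, e₃) = 1`. -/
def IsSU3Structure (ψ : DForm n M 3 ℂ) : Prop :=
  S.IsType30 ψ ∧ ∀ x : M, ∃ e : Fin 3 → TangentSpace (𝓡 n) x,
    (∀ i j, S.g.inner x (e i) (e j) = if i = j then 1 else 0) ∧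
    (∀ i j, S.g.inner x (e i) (S.J x (e j)) = 0) ∧ ψ x e = 1

end AlmostHermitian

end AlmostHermitian

/-! Write `N` for the Nijenhuis tensor and recall that `(∇_u σ)(v, w) = g((∇_u J) v, w)`. On a
six-dimensional Hermitian space, a real three-form `A` of type `(3,0) + (0,3)` is the real part of
`c · det` in complex coordinates. Hence it is nondegenerate unless `c = 0` (`eq_zero_of_forall`),
and it obeys the constant type identity (`apply_of_inner_eq`): if `K` is dual to `A(u, v, ·)`, then
`A(K, ·, ·)` is `|c|²` times a fixed expression in `g` and `σ`. The differential input is an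
integrability identity (`extDeriv_sub_extDeriv_of_type30`, `IsTypePair.d_sub_d`): if `A + iB` is of
type `(3,0)` and `dA = 0`, then `dB(u, v, w, z) - dB(Ju, Jv, w, z) = -A(J N(u, v), w, z)`.

Suppose `M` is nearly Kähler. Then `∇σ` is totally skew, so `A = dσ/3 = ∇σ`; it is closed and of
type `(3,0) + (0,3)`, and it is completed by `B = A(J·, J·, J·)`. Here `N = -4 J ∇J`, so the two
identities determine `dB` algebraically: `dB = -2ρ σ ∧ σ` with `ρ = |c|²` (`eq_smul_wedge`).
Applying `d` gives `dρ ∧ σ ∧ σ + 2ρ dσ ∧ σ = 0`; the second term vanishes by type, so `dρ = 0`. By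
connectedness `ρ` is constant, and it is positive because `∇J` is not identically zero. Take `μ =
√ρ` and `ψ = μ⁻¹ (A + iB)`.

Conversely, the structure equations give `dA = 0` for `A = ψ₊`, and the integrability identity
computes `A(J N(u, v), ·, ·)`. Comparison with the constant type identity and nondegeneracy show
that `N` is `4μ/|c|²` times `A(·, ·, J·)`. Since `∇J` is determined by `N` and `dσ`
(`eq_of_nijenhuisOf_eq`), consistency with `dσ = 3μA` forces `|c|² = 1` and `∇σ = μA`. This is
totally skew and nonzero, which is the nearly Kähler condition, and `|c| = 1` gives the
`SU(3)`-structure after a rotation of the frame. -/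

/-! ### Linear algebra of a six-dimensional Hermitian space -/

section HermitianAlgebra

/-- A function of three vectors which is skew and complex linear with respect to coordinates `ζ`
is a multiple of the determinant. -/
theorem eq_mul_det_of_skew {V : Type*} (ψ : V → V → V → ℂ) (ζ : Fin 3 → V → ℂ) (e : Fin 3 → V)
    (h : ∀ u v w, ψ u v w =
      ζ 0 u * ψ (e 0) v w + ζ 1 u * ψ (e 1) v w + ζ 2 u * ψ (e 2) v w)
    (s₁ : ∀ u v w, ψ u v w = -ψ v u w) (s₂ : ∀ u v w, ψ u v w = -ψ u w v) (u v w : V) :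
    ψ u v w = ψ (e 0) (e 1) (e 2) *
      (ζ 0 u * (ζ 1 v * ζ 2 w - ζ 2 v * ζ 1 w) + ζ 1 u * (ζ 2 v * ζ 0 w - ζ 0 v * ζ 2 w)
        + ζ 2 u * (ζ 0 v * ζ 1 w - ζ 1 v * ζ 0 w)) := by
  have z : ∀ a b, ψ a a b = 0 := fun a b ↦ by
    have := s₁ a a b; linear_combination this / 2
  have z' : ∀ a b, ψ a b b = 0 := fun a b ↦ by
    have := s₂ a b b; linear_combination this / 2
  have z'' : ∀ a b, ψ a b a = 0 := fun a b ↦ by rw [s₂, z, neg_zero]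
  -- Linearity is assumed in the first slot only; skewness carries it to the third slot here and to
  -- the second slot in `one`.
  have two : ∀ i j w, ψ (e i) (e j) w =
      ζ 0 w * ψ (e 0) (e i) (e j) + ζ 1 w * ψ (e 1) (e i) (e j)
        + ζ 2 w * ψ (e 2) (e i) (e j) := fun i j w ↦ by
    rw [← h w (e i) (e j), s₂, s₁]; ring
  have one : ∀ i v w, ψ (e i) v w =
      ζ 0 v * ψ (e i) (e 0) w + ζ 1 v * ψ (e i) (e 1) w + ζ 2 v * ψ (e i) (e 2) w :=
    fun i v w ↦ by
    rw [s₁, h v (e i) w, s₁ (e 0), s₁ (e 1), s₁ (e 2)]; ring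
  have p1 : ψ (e 1) (e 2) (e 0) = ψ (e 0) (e 1) (e 2) := by rw [s₂, s₁]; ring
  have p2 : ψ (e 2) (e 0) (e 1) = ψ (e 0) (e 1) (e 2) := by rw [s₁, s₂]; ring
  have p3 : ψ (e 0) (e 2) (e 1) = -ψ (e 0) (e 1) (e 2) := by rw [s₂]
  have p4 : ψ (e 1) (e 0) (e 2) = -ψ (e 0) (e 1) (e 2) := by rw [s₁]
  have p5 : ψ (e 2) (e 1) (e 0) = -ψ (e 0) (e 1) (e 2) := by rw [s₁, p1]
  rw [h u v w, one 0, one 1, one 2]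
  simp only [two _ _ w, z, z', z'', p1, p2, p3, p4, p5]
  ring

variable {V : Type*} [AddCommGroup V] [Module ℝ V]

/-- `e₀, e₁, e₂` is a unitary frame for the Hermitian structure `(g, J)`. -/
structure IsUnitaryFrame (g : V →ₗ[ℝ] V →ₗ[ℝ] ℝ) (J : V →ₗ[ℝ] V) (e : Fin 3 → V) : Prop where
  inner_eq : ∀ i j, g (e i) (e j) = if i = j then 1 else 0
  inner_J_eq : ∀ i j, g (e i) (J (e j)) = 0

/-- A Hermitian structure on a real vector space. -/
structure IsHermitian (g : V →ₗ[ℝ] V →ₗ[ℝ] ℝ) (J : V →ₗ[ℝ] V) : Prop where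
  symm : ∀ u v, g u v = g v u
  pos : ∀ v, v ≠ 0 → 0 < g v v
  J_J : ∀ v, J (J v) = -v
  g_J_J : ∀ u v, g (J u) (J v) = g u v

/-- The complex coordinate of `u` along a unit vector `e`. -/
noncomputable def complexCoord (g : V →ₗ[ℝ] V →ₗ[ℝ] ℝ) (J : V →ₗ[ℝ] V) (e u : V) : ℂ :=
  ⟨g e u, g (J e) u⟩

variable {g : V →ₗ[ℝ] V →ₗ[ℝ] ℝ} {J : V →ₗ[ℝ] V} {e : Fin 3 → V}

namespace IsHermitian

variable (hg : IsHermitian g J)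
include hg

theorem g_J_left (u v : V) : g (J u) v = -g u (J v) := by
  have := hg.g_J_J u (J v)
  rw [hg.J_J] at this
  simp only [map_neg] at this
  linarith

theorem g_J_self (u : V) : g (J u) u = 0 := by
  have h1 := hg.g_J_left u u
  have h2 := hg.symm u (J u)
  linarith

theorem eq_of_inner_eq {u v : V} (h : ∀ w, g u w = g v w) : u = v := by
  by_contra hne
  have := hg.pos _ (sub_ne_zero.2 hne)
  rw [LinearMap.map_sub g, LinearMap.sub_apply, h, sub_self] at this
  exact lt_irrefl _ this

/-- Fewer than `dim V` vectors have a common unit normal. -/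
theorem exists_unit_normal [FiniteDimensional ℝ V] {m : ℕ} (f : Fin m → V)
    (hm : m < Module.finrank ℝ V) : ∃ u, g u u = 1 ∧ ∀ i, g (f i) u = 0 := by
  let Φ : V →ₗ[ℝ] Fin m → ℝ := LinearMap.pi fun i ↦ g (f i)
  have hker : LinearMap.ker Φ ≠ ⊥ := LinearMap.ker_ne_bot_of_finrank_lt (by simpa using hm)
  obtain ⟨u, hu, hu0⟩ := (Submodule.ne_bot_iff _).1 hker
  have hp := hg.pos u hu0
  have hs : Real.sqrt (g u u) * Real.sqrt (g u u) = g u u := Real.mul_self_sqrt hp.le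
  have hs0 : Real.sqrt (g u u) ≠ 0 := (Real.sqrt_pos.2 hp).ne'
  refine ⟨(Real.sqrt (g u u))⁻¹ • u, ?_, fun i ↦ ?_⟩
  · simp only [map_smul, LinearMap.smul_apply, smul_eq_mul]
    field_simp
    rw [sq, hs]
  · have : g (f i) u = 0 := congrFun (LinearMap.mem_ker.1 hu) i
    rw [map_smul, this, smul_zero]

theorem isUnitaryFrame (h0 : ∀ i, g (e i) (e i) = 1)
    (h : g (e 0) (e 1) = 0 ∧ g (e 0) (e 2) = 0 ∧ g (e 1) (e 2) = 0)
    (h' : g (J (e 0)) (e 1) = 0 ∧ g (J (e 0)) (e 2) = 0 ∧ g (J (e 1)) (e 2) = 0) :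
    IsUnitaryFrame g J e := by
  obtain ⟨a, b, c⟩ := h
  obtain ⟨a', b', c'⟩ := h'
  have q : ∀ u v, g u (J v) = -g (J u) v := fun u v ↦ by rw [hg.g_J_left, neg_neg]
  have q' : ∀ u v, g (J u) v = 0 → g (J v) u = 0 := fun u v h ↦ by
    rw [hg.g_J_left, hg.symm, h, neg_zero]
  constructor
  · intro i j
    fin_cases i <;> fin_cases j <;> simp [h0, a, b, c, hg.symm (e 1) (e 0), hg.symm (e 2)]
  · intro i j
    rw [q]
    fin_cases i <;> fin_cases j <;> simp [hg.g_J_self, a', b', c', q']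

/-- Every unit vector is the first vector of a unitary frame. -/
theorem exists_isUnitaryFrame (hV : Module.finrank ℝ V = 6) {u : V} (hu : g u u = 1) :
    ∃ e, IsUnitaryFrame g J e ∧ e 2 = u := by
  have : FiniteDimensional ℝ V := Module.finite_of_finrank_pos (by omega)
  obtain ⟨v, hv, hv'⟩ := hg.exists_unit_normal ![u, J u] (by omega)
  obtain ⟨w, hw, hw'⟩ := hg.exists_unit_normal ![u, J u, v, J v] (by omega)
  have a1 := hv' 0
  have a2 := hv' 1
  have b1 := hw' 0
  have b2 := hw' 1
  have b3 := hw' 2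
  have b4 := hw' 3
  simp at a1 a2 b1 b2 b3 b4
  have q' : ∀ u v, g (J u) v = 0 → g (J v) u = 0 := fun u v h ↦ by
    rw [hg.g_J_left, hg.symm, h, neg_zero]
  refine ⟨![w, v, u], hg.isUnitaryFrame ?_ ?_ ?_, rfl⟩
  · intro i; fin_cases i <;> simp [hu, hv, hw]
  · simp [hg.symm w, hg.symm v u, a1, b1, b3]
  · simp [q', a2, b2, b4]

/-- A unitary frame of a six-dimensional Hermitian space is a complex basis. -/
theorem eq_sum_frame (hV : Module.finrank ℝ V = 6) (he : IsUnitaryFrame g J e) (u : V) :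
    u = ∑ i, (g (e i) u • e i + g (J (e i)) u • J (e i)) := by
  have : FiniteDimensional ℝ V := Module.finite_of_finrank_pos (by omega)
  have hJe : ∀ i j, g (J (e i)) (e j) = 0 := fun i j ↦ by
    rw [hg.g_J_left, he.inner_J_eq, neg_zero]
  set r := u - ∑ i, (g (e i) u • e i + g (J (e i)) u • J (e i)) with hr
  have h1 : ∀ i, g (e i) r = 0 := fun i ↦ by
    rw [hr]
    simp [Finset.sum_add_distrib, he.inner_eq, he.inner_J_eq]
  have h2 : ∀ i, g (J (e i)) r = 0 := fun i ↦ by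
    rw [hr]
    simp [Finset.sum_add_distrib, he.inner_eq, hJe, hg.g_J_J]
  by_contra hne
  have hr0 : r ≠ 0 := sub_ne_zero.2 hne
  have hrp := hg.pos r hr0
  -- A nonzero remainder `r` would complete the frame and its image under `J` to seven nonzero
  -- orthogonal vectors in dimension six.
  let f : Fin 3 ⊕ Fin 3 ⊕ Unit → V := Sum.elim e (Sum.elim (fun i ↦ J (e i)) fun _ ↦ r)
  have hf : ∀ i j, i ≠ j → g (f i) (f j) = 0 := by
    rintro (i | i | i) (j | j | j) hij
    · simp only [ne_eq, Sum.inl.injEq] at hij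
      simp [f, he.inner_eq, hij]
    · exact he.inner_J_eq i j
    · exact h1 i
    · exact hJe i j
    · simp only [ne_eq, Sum.inl.injEq, Sum.inr.injEq] at hij
      simp [f, he.inner_eq, hg.g_J_J, hij]
    · exact h2 i
    · exact (hg.symm _ _).trans (h1 j)
    · exact (hg.symm _ _).trans (h2 j)
    · exact absurd rfl hij
  have hf' : ∀ i, g (f i) (f i) ≠ 0 := by
    rintro (i | i | i)
    · simp [f, he.inner_eq]
    · simp [f, hg.g_J_J, he.inner_eq]
    · exact hrp.ne'
  have hli : LinearIndependent ℝ f := by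
    rw [Fintype.linearIndependent_iff]
    intro c hc i
    have h3 := congrArg (g (f i)) hc
    rw [map_sum, Finset.sum_eq_single i, map_smul, smul_eq_mul, map_zero] at h3
    · exact (mul_eq_zero.1 h3).resolve_right (hf' i)
    · intro j _ hji
      rw [map_smul, hf i j hji.symm, smul_zero]
    · simp
  have := hli.fintype_card_le_finrank
  simp [hV] at this

/-- Both components of the Hermitian form `g + iσ` are kept, so that such values can be multiplied
in `ℂ` in the constant type identity. The form is conjugate linear in `u`. -/
theorem inner_eq_re (hV : Module.finrank ℝ V = 6) (he : IsUnitaryFrame g J e) (u w : V) : (⟨g u w, g (J u) w⟩ : ℂ) =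
    ∑ i, star (complexCoord g J (e i) u) * complexCoord g J (e i) w := by
  have hu := hg.eq_sum_frame hV he u
  have h1 : g u w = ∑ i, (g (e i) u * g (e i) w + g (J (e i)) u * g (J (e i)) w) := by
    conv_lhs => rw [hu]
    simp [Fin.sum_univ_three]
  have h2 : g (J u) w = ∑ i, (g (e i) u * g (J (e i)) w - g (J (e i)) u * g (e i) w) := by
    conv_lhs => rw [hu]
    simp [Fin.sum_univ_three, hg.J_J]
    ring
  rw [Fin.sum_univ_three] at h1 h2
  rw [Fin.sum_univ_three]
  apply Complex.ext
  · simp [complexCoord, h1]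
  · simp [complexCoord, h2]; ring

theorem exists_inner_eq (hV : Module.finrank ℝ V = 6) (he : IsUnitaryFrame g J e)
    (φ : V →ₗ[ℝ] ℝ) : ∃ K, ∀ z, g K z = φ z := by
  refine ⟨∑ i, (φ (e i) • e i + φ (J (e i)) • J (e i)), fun z ↦ ?_⟩
  have h : φ z = ∑ i, (g (e i) z * φ (e i) + g (J (e i)) z * φ (J (e i))) := by
    conv_lhs => rw [hg.eq_sum_frame hV he z]
    simp
  rw [h]
  simp [mul_comm]

end IsHermitian

/-- A skew trilinear form which is of type `(3,0) + (0,3)`. -/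
structure IsRealType30 (J : V →ₗ[ℝ] V) (A : V →ₗ[ℝ] V →ₗ[ℝ] V →ₗ[ℝ] ℝ) : Prop where
  swap₁ : ∀ u v w, A u v w = -A v u w
  swap₂ : ∀ u v w, A u v w = -A u w v
  J_left : ∀ u v w, A (J u) v w = A u (J v) w

/-- The square of the norm of a form of type `(3,0) + (0,3)`, computed in a unitary frame. -/
noncomputable def normSqInFrame (J : V →ₗ[ℝ] V) (A : V →ₗ[ℝ] V →ₗ[ℝ] V →ₗ[ℝ] ℝ) (e : Fin 3 → V) :
    ℝ := A (e 0) (e 1) (e 2) ^ 2 + A (J (e 0)) (e 1) (e 2) ^ 2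

namespace IsRealType30

variable {A : V →ₗ[ℝ] V →ₗ[ℝ] V →ₗ[ℝ] ℝ} (hA : IsRealType30 J A)
include hA

theorem rotate (u v w : V) : A u v w = A v w u := by
  rw [hA.swap₁, hA.swap₂]; ring

theorem J_mid (u v w : V) : A u (J v) w = A u v (J w) := by
  rw [hA.rotate, hA.J_left, ← hA.rotate]

variable (hg : IsHermitian g J) (he : IsUnitaryFrame g J e) (hV : Module.finrank ℝ V = 6)
include hg he hV

/-- The function `A - i A(J·, ·, ·)` is complex linear for `J` and has real part `A`; in complex
dimension three a skew form of degree three is a multiple of the determinant. -/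
theorem complex_eq_det (u v w : V) : (⟨A u v w, -A (J u) v w⟩ : ℂ) =
    ⟨A (e 0) (e 1) (e 2), -A (J (e 0)) (e 1) (e 2)⟩ *
      let ζ i u := complexCoord g J (e i) u
      (ζ 0 u * (ζ 1 v * ζ 2 w - ζ 2 v * ζ 1 w) + ζ 1 u * (ζ 2 v * ζ 0 w - ζ 0 v * ζ 2 w)
        + ζ 2 u * (ζ 0 v * ζ 1 w - ζ 1 v * ζ 0 w)) := by
  refine eq_mul_det_of_skew (fun u v w ↦ ⟨A u v w, -A (J u) v w⟩)
    (fun i u ↦ complexCoord g J (e i) u) e ?_ ?_ ?_ u v w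
  · intro u v w
    have hu := hg.eq_sum_frame hV he u
    have h1 : A u v w = ∑ i, (g (e i) u * A (e i) v w + g (J (e i)) u * A (J (e i)) v w) := by
      conv_lhs => rw [hu]
      simp [Fin.sum_univ_three]
    have h2 : A (J u) v w =
        ∑ i, (g (e i) u * A (J (e i)) v w - g (J (e i)) u * A (e i) v w) := by
      conv_lhs => rw [hu]
      simp [Fin.sum_univ_three, hg.J_J]
      ring
    rw [Fin.sum_univ_three] at h1 h2
    apply Complex.ext
    · simp [complexCoord, h1]
    · simp [complexCoord, h2]; ring
  · intro u v w
    apply Complex.ext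
    · simpa using hA.swap₁ u v w
    · have := hA.swap₁ (J u) v w
      rw [← hA.J_left] at this
      simpa [neg_eq_iff_eq_neg] using this
  · intro u v w
    apply Complex.ext
    · simpa using hA.swap₂ u v w
    · simpa [neg_eq_iff_eq_neg] using hA.swap₂ (J u) v w

/-- A nonzero multiple of the determinant is nondegenerate: two frame vectors in the last slots
isolate one coordinate of `n`. -/
theorem eq_zero_of_forall (hne : normSqInFrame J A e ≠ 0) {n : V} (h : ∀ v w, A n v w = 0) :
    n = 0 := by
  have hJn : ∀ v w, A (J n) v w = 0 := fun v w ↦ by rw [hA.J_left, h]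
  have hc : (⟨A (e 0) (e 1) (e 2), -A (J (e 0)) (e 1) (e 2)⟩ : ℂ) ≠ 0 := by
    intro h0
    apply hne
    have h1 := congrArg Complex.re h0
    have h2 := congrArg Complex.im h0
    simp at h1 h2
    simp [normSqInFrame, h1, h2]
  have hJe : ∀ i j, g (J (e i)) (e j) = 0 := fun i j ↦ by
    rw [hg.g_J_left, he.inner_J_eq, neg_zero]
  have z : ∀ i j, complexCoord g J (e i) (e j) = if i = j then 1 else 0 := fun i j ↦ by
    apply Complex.ext <;> simp only [complexCoord, he.inner_eq, hJe] <;> split <;> simp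
  have key : ∀ v w, _ := fun v w ↦ complex_eq_det hA hg he hV n v w
  simp only [h, hJn, neg_zero] at key
  have zero : (⟨0, 0⟩ : ℂ) = 0 := rfl
  have k : ∀ i, complexCoord g J (e i) n = 0 := by
    intro i
    fin_cases i
    · simpa [z, zero, hc] using key (e 1) (e 2)
    · simpa [z, zero, hc] using key (e 2) (e 0)
    · simpa [z, zero, hc] using key (e 0) (e 1)
  rw [hg.eq_sum_frame hV he n]
  refine Finset.sum_eq_zero fun i _ ↦ ?_
  have h1 : g (e i) n = 0 := congrArg Complex.re (k i)
  have h2 : g (J (e i)) n = 0 := congrArg Complex.im (k i)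
  rw [h1, h2, zero_smul, zero_smul, add_zero]

/-- The constant type identity. -/
theorem apply_of_inner_eq {u v K : V} (hK : ∀ z, g K z = A u v z) (w z : V) :
    A K w z = normSqInFrame J A e * (g u w * g v z - g u z * g v w
      - g (J u) w * g (J v) z + g (J u) z * g (J v) w) := by
  set c : ℂ := ⟨A (e 0) (e 1) (e 2), -A (J (e 0)) (e 1) (e 2)⟩ with hc
  have hcc : star c * c = normSqInFrame J A e := by
    apply Complex.ext
    · simp only [hc, normSqInFrame, Complex.star_def, Complex.mul_re, Complex.conj_re,
        Complex.conj_im, Complex.ofReal_re]; ring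
    · simp [hc]; ring
  have hJe : ∀ i j, g (J (e i)) (e j) = 0 := fun i j ↦ by
    rw [hg.g_J_left, he.inner_J_eq, neg_zero]
  have zz : ∀ i j, complexCoord g J (e i) (e j) = if i = j then 1 else 0 := fun i j ↦ by
    apply Complex.ext <;> simp only [complexCoord, he.inner_eq, hJe] <;> split <;> simp
  -- Duality makes the coordinates of `K` conjugates of values on the `e i`, hence `star c` times
  -- conjugated `2 × 2` minors of the coordinates of `u` and `v`.
  have hζ : ∀ i, complexCoord g J (e i) K = star (⟨A u v (e i), -A (J u) v (e i)⟩ : ℂ) := by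
    intro i
    apply Complex.ext
    · simpa [complexCoord, hg.symm (e i)] using hK (e i)
    · have := hK (J (e i))
      rw [← hA.J_mid, ← hA.J_left] at this
      simpa [complexCoord, hg.symm (J (e i))] using this
  have h1 := complex_eq_det hA hg he hV K w z
  have h2 := fun i ↦ complex_eq_det hA hg he hV u v (e i)
  have i1 := hg.inner_eq_re hV he u w
  have i2 := hg.inner_eq_re hV he v z
  have i3 := hg.inner_eq_re hV he u z
  have i4 := hg.inner_eq_re hV he v w
  rw [Fin.sum_univ_three] at i1 i2 i3 i4
  simp only [hζ, h2, ← hc, zz] at h1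
  -- Lagrange's identity: the Hermitian product of the minors of `(u, v)` with those of `(w, z)` is
  -- the Gram determinant. Its real part is the claim.
  have h3 : (⟨A K w z, -A (J K) w z⟩ : ℂ) = normSqInFrame J A e *
      ((⟨g u w, g (J u) w⟩ : ℂ) * ⟨g v z, g (J v) z⟩ - ⟨g u z, g (J u) z⟩ * ⟨g v w, g (J v) w⟩) := by
    rw [h1, i1, i2, i3, i4, ← hcc]
    simp
    ring
  have h4 := congrArg Complex.re h3
  simp at h4
  rw [h4]
  ring

end IsRealType30

/-- The algebraic expression of the Nijenhuis tensor in terms of the derivative of `J`. -/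
def nijenhuisOf (J : V →ₗ[ℝ] V) (T : V → V → V) (u v : V) : V :=
  T (J u) v - T (J v) u + J (T v u - T u v)

theorem IsHermitian.inner_nijenhuisOf (hg : IsHermitian g J) (T : V → V → V) (u v w : V) :
    g (nijenhuisOf J T u v) w = g (T (J u) v) w - g (T (J v) u) w
      + g (T u v) (J w) - g (T v u) (J w) := by
  simp only [nijenhuisOf, map_add, map_sub, LinearMap.add_apply, LinearMap.sub_apply,
    hg.g_J_left]
  ring

namespace IsRealType30

variable {A : V →ₗ[ℝ] V →ₗ[ℝ] V →ₗ[ℝ] ℝ} (hA : IsRealType30 J A) (hg : IsHermitian g J)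
include hA hg

/-- The four terms of the Nijenhuis tensor coincide once `J` is moved to the last slot. -/
theorem inner_nijenhuisOf {T : V → V → V} (hT : ∀ u v w, g (T u v) w = A u v w) (u v w : V) :
    g (nijenhuisOf J T u v) w = 4 * A u v (J w) := by
  rw [hg.inner_nijenhuisOf, hT, hT, hT, hT, hA.J_left, hA.J_mid, hA.J_left v, hA.J_mid,
    hA.swap₁ v]
  ring

theorem nijenhuisOf_eq {T : V → V → V} (hT : ∀ u v w, g (T u v) w = A u v w) (u v : V) :
    nijenhuisOf J T u v = -(4 : ℝ) • J (T u v) := by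
  refine hg.eq_of_inner_eq fun w ↦ ?_
  rw [hA.inner_nijenhuisOf hg hT, map_smul, LinearMap.smul_apply, hg.g_J_left, hT]
  simp

variable (he : IsUnitaryFrame g J e) (hV : Module.finrank ℝ V = 6)
include he hV

/-- A four-form `β` is determined by the components `β(u, v, w, z) - β(J u, J v, w, z)`, when these
come from a totally skew `∇ J`. -/
theorem eq_smul_wedge {T : V → V → V} (hT : ∀ u v w, g (T u v) w = A u v w)
    {β : V → V → V → V → ℝ} (hneg : ∀ u v w z, β (-u) v w z = -β u v w z)
    (s₁ : ∀ u v w z, β u v w z = -β v u w z)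
    (s₂ : ∀ u v w z, β u v w z = -β u w v z)
    (hβ : ∀ u v w z, β u v w z - β (J u) (J v) w z = -A (J (nijenhuisOf J T u v)) w z)
    (u v w z : V) :
    β u v w z = -4 * normSqInFrame J A e * (g (J u) v * g (J w) z - g (J u) w * g (J v) z
      + g (J u) z * g (J v) w) := by
  have hQ : ∀ u v w z, β u v w z - β (J u) (J v) w z = -4 * A (T u v) w z := by
    intro u v w z
    rw [hβ, hA.nijenhuisOf_eq hg hT]
    simp [hg.J_J]
  have c : ∀ u v w z, β u v w z = β v w u z := fun u v w z ↦ by rw [s₁, s₂]; ring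
  -- In the sum of these three instances the components `β(Ju, Jv, w, z)` and `β(Ju, v, Jw, z)`
  -- cancel and `2 β(u, v, w, z)` remains.
  have q1 := hQ u v w z
  have q3 := hQ (J v) w (J u) z
  have q4 := hQ w u v z
  simp only [hA.apply_of_inner_eq hg he hV (hT _ _)] at q1 q3 q4
  have e1 : β (J v) w (J u) z = β (J u) (J v) w z := (c _ _ _ _).symm
  have e2 : β v (J w) (J u) z = β (J u) v (J w) z := (c _ _ _ _).symm
  have e3 : β (J w) (J u) v z = β (J u) v (J w) z := c _ _ _ _
  have e4 : β w u v z = β u v w z := c _ _ _ _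
  have σ_swap : ∀ a b, g (J a) b = -g (J b) a := fun a b ↦ by rw [hg.g_J_left, hg.symm]
  simp only [hg.J_J, hneg, e1, e2, map_neg, LinearMap.neg_apply, hg.g_J_J, hg.symm v (J u),
    hg.symm w (J u), hg.symm v u, hg.symm w u] at q3
  rw [e3, e4, hg.symm w v, σ_swap w v] at q4
  linear_combination (q1 + q3 + q4) / 2

end IsRealType30

/-- A tensor with the symmetries of `∇ σ` is determined by its Nijenhuis tensor and its exterior
derivative. -/
theorem eq_of_nijenhuisOf_eq (hg : IsHermitian g J)
    {A : V →ₗ[ℝ] V →ₗ[ℝ] V →ₗ[ℝ] ℝ} (hA : IsRealType30 J A) (hne : ∃ u v w, A u v w ≠ 0)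
    {T : V → V → V} (hTs : ∀ u v w, g (T u v) w = -g (T u w) v)
    (hTJ : ∀ u v, T u (J v) = -J (T u v)) {r κ : ℝ}
    (hN : ∀ u v w, g (nijenhuisOf J T u v) w = 4 * r * A u v (J w))
    (hd : ∀ u v w, g (T u v) w + g (T v w) u + g (T w u) v = 3 * κ * A u v w) :
    κ = r ∧ ∀ u v w, g (T u v) w = r * A u v w := by
  -- By `hN`, the expected solution `r A` has the same Nijenhuis tensor as `T`, so that of the
  -- difference `D` vanishes; `c₁` expresses this.
  set D : V → V → V → ℝ := fun u v w ↦ g (T u v) w - r * A u v w with hD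
  have d₁ : ∀ u v w, D u v w = -D u w v := fun u v w ↦ by
    simp only [hD]; rw [hTs, hA.swap₂]; ring
  have d₂ : ∀ u v w, D u (J v) w = D u v (J w) := fun u v w ↦ by
    simp only [hD]
    rw [hTJ, hA.J_mid, map_neg, LinearMap.neg_apply, hg.g_J_left, neg_neg]
  have dn : ∀ u v w, D u v (-w) = -D u v w := fun u v w ↦ by
    simp only [hD, map_neg]; ring
  have c₁ : ∀ u v w, D (J u) v w + D u v (J w) = D (J v) u w + D v u (J w) := fun u v w ↦ by
    have h := hN u v w
    rw [hg.inner_nijenhuisOf] at h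
    simp only [hD]
    rw [hA.J_left, hA.J_mid, hA.J_left v, hA.J_mid v, hA.swap₁ v]
    linear_combination h
  have c₂ : ∀ u v w, D (J u) v w + D u v (J w) = -(D (J u) w v + D u w (J v)) := fun u v w ↦ by
    rw [d₁, ← d₂, d₁ u (J v)]; ring
  -- The sum `D(Ju, v, w) + D(u, v, Jw)` is symmetric in `u, v` by `c₁` and skew in `v, w` by `c₂`;
  -- such a trilinear expression is zero.
  have c₀ : ∀ u v w, D (J u) v w = -D u v (J w) := fun u v w ↦ by
    have e1 := c₁ u v w
    have e2 := c₂ v u w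
    have e3 := c₁ v w u
    have e4 := c₂ w v u
    have e5 := c₁ w u v
    have e6 := c₂ u w v
    linarith
  have hcyc : ∀ u v w, D u v w + D v w u + D w u v = 3 * (κ - r) * A u v w := fun u v w ↦ by
    have h := hd u v w
    simp only [hD]
    rw [← hA.rotate u v w, hA.rotate w u v]
    linear_combination h
  have a : ∀ u v w, D u v (J w) = 3 * (κ - r) * A u v (J w) := by
    -- Adding the cyclic identities for `(u, v, Jw)` and `(Ju, v, w)` leaves a single term of `D`,
    -- by `c₀` and `d₂`.
    have : ∀ u v w, D v w (J u) = 3 * (κ - r) * A u v (J w) := fun u v w ↦ by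
      have h1 := hcyc u v (J w)
      have h2 := hcyc (J u) v w
      rw [d₂ v w u, c₀] at h1
      rw [c₀, d₂ w u v, hA.J_left, hA.J_mid] at h2
      linarith
    intro u v w
    rw [this w u v, hA.rotate, hA.J_mid]
  have a' : ∀ u v w, D u v w = 3 * (κ - r) * A u v w := fun u v w ↦ by
    have := a u v (J w)
    rw [hg.J_J, dn, map_neg] at this
    linarith
  -- Passing `J` from the first to the last slot changes the sign for `D` but not for `A`, so a
  -- multiple of `A` that equals `D` is zero.
  have a₀ : ∀ u v w, 3 * (κ - r) * A u v w = 0 := fun u v w ↦ by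
    have h1 := a' (J u) v (J w)
    have h2 := a u v (J w)
    rw [c₀, hA.J_left, hA.J_mid, h2] at h1
    rw [hg.J_J, map_neg] at h1
    linarith
  obtain ⟨u₀, v₀, w₀, h₀⟩ := hne
  refine ⟨?_, fun u v w ↦ ?_⟩
  · have := (mul_eq_zero.1 (a₀ u₀ v₀ w₀)).resolve_right h₀
    linarith
  · have h := a' u v w
    rw [a₀] at h
    simp only [hD] at h
    linarith

namespace IsRealType30

variable {A : V →ₗ[ℝ] V →ₗ[ℝ] V →ₗ[ℝ] ℝ} (hA : IsRealType30 J A) (hg : IsHermitian g J)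
  (hV : Module.finrank ℝ V = 6) (he : IsUnitaryFrame g J e)
include hA hg hV he

theorem eq_zero_of_normSqInFrame (h : normSqInFrame J A e = 0) (u v w : V) : A u v w = 0 := by
  have h1 : A (e 0) (e 1) (e 2) = 0 := by
    unfold normSqInFrame at h
    nlinarith [sq_nonneg (A (e 0) (e 1) (e 2)), sq_nonneg (A (J (e 0)) (e 1) (e 2))]
  have h2 : A (J (e 0)) (e 1) (e 2) = 0 := by
    unfold normSqInFrame at h
    nlinarith [sq_nonneg (A (e 0) (e 1) (e 2)), sq_nonneg (A (J (e 0)) (e 1) (e 2))]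
  have := complex_eq_det hA hg he hV u v w
  rw [h1, h2, neg_zero] at this
  have h3 := congrArg Complex.re this
  have zero : (⟨0, 0⟩ : ℂ) = 0 := rfl
  rw [zero, zero_mul] at h3
  exact h3

/-- The pointwise content of the structure equations: the form has norm one and `∇ J` is totally
skew. -/
theorem inner_eq_of_structure_equations {μ : ℝ} (hμ : μ ≠ 0) {T : V → V → V}
    (hTs : ∀ u v w, g (T u v) w = -g (T u w) v) (hTJ : ∀ u v, T u (J v) = -J (T u v))
    (hd : ∀ u v w, g (T u v) w + g (T v w) u + g (T w u) v = 3 * μ * A u v w)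
    (hβ : ∀ u v w z, A (J (nijenhuisOf J T u v)) w z = 4 * μ * (g u w * g v z - g u z * g v w
      - g (J u) w * g (J v) z + g (J u) z * g (J v) w)) :
    normSqInFrame J A e = 1 ∧ ∀ u v w, g (T u v) w = μ * A u v w := by
  have hne : normSqInFrame J A e ≠ 0 := by
    intro h0
    -- On these vectors the right-hand side is `4μ`, whereas a vanishing norm would make the
    -- left-hand side zero.
    have h := hβ (e 0) (e 1) (e 0) (e 1)
    rw [eq_zero_of_normSqInFrame hA hg hV he h0] at h
    have q : ∀ i j, g (J (e i)) (e j) = 0 := fun i j ↦ by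
      rw [hg.g_J_left, he.inner_J_eq, neg_zero]
    simp [he.inner_eq, q, hμ] at h
  have hN : ∀ u v w, g (nijenhuisOf J T u v) w =
      4 * (μ / normSqInFrame J A e) * A u v (J w) := by
    intro u v w
    obtain ⟨K, hK⟩ := hg.exists_inner_eq hV he (A u v)
    -- By the constant type identity both vectors have the same contraction with `A`, and `A` is
    -- nondegenerate.
    have h : J (nijenhuisOf J T u v) - (4 * (μ / normSqInFrame J A e)) • K = 0 := by
      refine hA.eq_zero_of_forall hg he hV hne fun w z ↦ ?_
      simp only [map_sub, map_smul, LinearMap.sub_apply, LinearMap.smul_apply, smul_eq_mul, hβ,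
        hA.apply_of_inner_eq hg he hV hK]
      field_simp
      ring
    rw [← hg.g_J_J, sub_eq_zero.1 h, map_smul, LinearMap.smul_apply, hK, smul_eq_mul]
  have hA0 : ∃ u v w, A u v w ≠ 0 := by
    by_contra! h
    exact hne (by simp [normSqInFrame, h])
  -- Used with `κ = μ` and `r = μ / |A|²`: the equality `κ = r` says that the norm is one.
  obtain ⟨h1, h2⟩ := eq_of_nijenhuisOf_eq hg hA hA0 hTs hTJ hN hd
  have h3 : normSqInFrame J A e = 1 := by
    field_simp at h1
    exact h1
  refine ⟨h3, fun u v w ↦ ?_⟩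
  rw [h2, ← h1]

end IsRealType30

/-- A unitary frame can be rotated so that a form of norm one takes the value `1`. -/
theorem IsHermitian.exists_frame_eq_one (hg : IsHermitian g J) (he : IsUnitaryFrame g J e)
    (A : V →ₗ[ℝ] V →ₗ[ℝ] V →ₗ[ℝ] ℝ) (h : normSqInFrame J A e = 1) :
    ∃ f, IsUnitaryFrame g J f ∧ A (f 0) (f 1) (f 2) = 1 ∧ A (J (f 0)) (f 1) (f 2) = 0 := by
  set p := A (e 0) (e 1) (e 2) with hp
  set q := A (J (e 0)) (e 1) (e 2) with hq
  have hpq : p ^ 2 + q ^ 2 = 1 := h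
  have hJe : ∀ i j, g (J (e i)) (e j) = 0 := fun i j ↦ by
    rw [hg.g_J_left, he.inner_J_eq, neg_zero]
  -- The complex value of the form on `e` is `p - iq`, of modulus one; multiplying the first vector
  -- by the phase `p + iq` turns it into `1`.
  refine ⟨![p • e 0 + q • J (e 0), e 1, e 2], hg.isUnitaryFrame ?_ ?_ ?_, ?_, ?_⟩
  · intro i
    fin_cases i
    · simp [he.inner_eq, he.inner_J_eq, hJe, hg.g_J_J]
      linarith
    · simp [he.inner_eq]
    · simp [he.inner_eq]
  · simp [he.inner_eq, hJe]
  · simp [he.inner_eq, hJe, hg.J_J]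
  · simp [← hp, ← hq]
    linarith
  · simp [← hp, ← hq, hg.J_J]
    ring

end HermitianAlgebra

/-! ### Differential forms in charts, smoothness and `d ∘ d = 0` -/

section FormsInCharts

/-- A family of alternating maps on a finite dimensional space is smooth if its values on fixed
vectors are. -/
theorem contDiffOn_continuousAlternatingMap_of_apply {D E F : Type*} [NormedAddCommGroup D]
    [NormedSpace ℝ D] [NormedAddCommGroup E] [NormedSpace ℝ E] [FiniteDimensional ℝ E]
    [NormedAddCommGroup F] [NormedSpace ℝ F] [FiniteDimensional ℝ F] {k : ℕ} {m : WithTop ℕ∞}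
    {f₀ : D → E [⋀^Fin k]→L[ℝ] F} {s : Set D} (h : ∀ v, ContDiffOn ℝ m (fun u ↦ f₀ u v) s) :
    ContDiffOn ℝ m f₀ s := by
  let b := Module.finBasis ℝ E
  let ev : (E [⋀^Fin k]→L[ℝ] F) →ₗ[ℝ] ((Fin k → Fin (Module.finrank ℝ E)) → F) :=
    { toFun := fun f t ↦ f fun i ↦ b (t i)
      map_add' := fun _ _ ↦ rfl
      map_smul' := fun _ _ ↦ rfl }
  have hinj : LinearMap.ker ev = ⊥ := by
    rw [LinearMap.ker_eq_bot]
    intro f f' hf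
    have h1 : f.toAlternatingMap.toMultilinearMap = f'.toAlternatingMap.toMultilinearMap :=
      Module.Basis.ext_multilinear (fun _ ↦ b) fun t ↦ congrFun hf t
    ext v
    exact congrArg (fun g : MultilinearMap ℝ (fun _ : Fin k ↦ E) F ↦ g v) h1
  obtain ⟨L, hL⟩ := LinearMap.exists_leftInverse_of_injective ev hinj
  have h2 : f₀ = fun u ↦ LinearMap.toContinuousLinearMap L (ev (f₀ u)) := by
    funext u
    exact congrArg (fun g : (E [⋀^Fin k]→L[ℝ] F) →ₗ[ℝ] _ ↦ g (f₀ u)) hL.symm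
  rw [h2]
  exact (LinearMap.toContinuousLinearMap L).contDiff.comp_contDiffOn
    (contDiffOn_pi.2 fun t ↦ h fun i ↦ b (t i))

theorem ContDiffOn.extDeriv {E F : Type*} [NormedAddCommGroup E] [NormedSpace ℝ E]
    [NormedAddCommGroup F] [NormedSpace ℝ F] {k : ℕ} {α : E → E [⋀^Fin k]→L[ℝ] F} {s : Set E}
    (h : ContDiffOn ℝ ∞ α s) (hs : IsOpen s) : ContDiffOn ℝ ∞ (extDeriv α) s := by
  have h1 : ContDiffOn ℝ ∞ (fderiv ℝ α) s := h.fderiv_of_isOpen hs (by simp)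
  have h2 : ContDiff ℝ ∞ (ContinuousAlternatingMap.alternatizeUncurryFinCLM (n := k) ℝ E F) :=
    ContinuousLinearMap.contDiff _
  exact h2.comp_contDiffOn h1

variable {n : ℕ} {M : Type*} [TopologicalSpace M] [ChartedSpace (EuclideanSpace ℝ (Fin n)) M]

theorem two_le_infty : (2 : WithTop ℕ∞) ≤ ∞ := by
  exact WithTop.coe_le_coe.2 (le_top : (2 : ℕ∞) ≤ ⊤)

theorem mdifferentiableAt_extChartAt_of_mem [IsManifold (𝓡 n) ∞ M] {x y : M}
    (hy : y ∈ (extChartAt (𝓡 n) x).source) :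
    MDifferentiableAt (𝓡 n) 𝓘(ℝ, EuclideanSpace ℝ (Fin n)) (extChartAt (𝓡 n) x) y := by
  have : IsManifold (𝓡 n) 1 M := IsManifold.of_le (n := ∞) (by simp)
  exact mdifferentiableAt_extChartAt (by simpa using hy)

theorem mdifferentiableAt_extChartAt_symm [IsManifold (𝓡 n) ∞ M] {x : M}
    {u : EuclideanSpace ℝ (Fin n)} (hu : u ∈ (extChartAt (𝓡 n) x).target) :
    MDifferentiableAt 𝓘(ℝ, EuclideanSpace ℝ (Fin n)) (𝓡 n) (extChartAt (𝓡 n) x).symm u := by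
  have : IsManifold (𝓡 n) 1 M := IsManifold.of_le (n := ∞) (by simp)
  have h := mdifferentiableWithinAt_extChartAt_symm hu
  simpa [mdifferentiableWithinAt_univ] using h

/-- The coordinate vector field of the preferred chart at `x` in the direction `v`. -/
noncomputable def coordField (x : M) (v : EuclideanSpace ℝ (Fin n)) (y : M) :
    TangentSpace (𝓡 n) y :=
  mfderiv 𝓘(ℝ, EuclideanSpace ℝ (Fin n)) (𝓡 n) (extChartAt (𝓡 n) x).symm (extChartAt (𝓡 n) x y) v

variable {k : ℕ} {F : Type*} [NormedAddCommGroup F] [NormedSpace ℝ F]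

namespace DForm

/-- Transport along an equality of base points: all tangent spaces are the same model space, so the
arguments need no cast. -/
theorem apply_congr (α : DForm n M k F) {y y' : M} (h : y' = y)
    (v : Fin k → EuclideanSpace ℝ (Fin n)) : α y' v = α y v := by
  subst h; rfl

theorem IsSmooth.contDiffAt {α : DForm n M k F} (hα : α.IsSmooth) {x : M}
    {u : EuclideanSpace ℝ (Fin n)} (hu : u ∈ (extChartAt (𝓡 n) x).target) :
    ContDiffAt ℝ ∞ (α.inChart x) u :=
  (hα x).contDiffAt ((isOpen_extChartAt_target x).mem_nhds hu)

theorem inChart_extChartAt_apply (α : DForm n M k F) {x y : M}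
    (hy : y ∈ (extChartAt (𝓡 n) x).source) (v : Fin k → EuclideanSpace ℝ (Fin n)) :
    α.inChart x (extChartAt (𝓡 n) x y) v = α y fun i ↦ coordField x (v i) y :=
  α.apply_congr ((extChartAt (𝓡 n) x).left_inv hy) _

theorem inChart_apply (α : DForm n M k F) {x : M} {u : EuclideanSpace ℝ (Fin n)}
    (hu : u ∈ (extChartAt (𝓡 n) x).target) (v : Fin k → EuclideanSpace ℝ (Fin n)) :
    α.inChart x u v = α ((extChartAt (𝓡 n) x).symm u)
      fun i ↦ coordField x (v i) ((extChartAt (𝓡 n) x).symm u) := by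
  rw [← inChart_extChartAt_apply α ((extChartAt (𝓡 n) x).map_target hu),
    (extChartAt (𝓡 n) x).right_inv hu]

end DForm

variable [IsManifold (𝓡 n) ∞ M]

theorem coordField_eq_symmL {x y : M} (hy : y ∈ (extChartAt (𝓡 n) x).source)
    (v : EuclideanSpace ℝ (Fin n)) : coordField x v y =
      (trivializationAt (EuclideanSpace ℝ (Fin n)) (TangentSpace (𝓡 n)) x).symmL ℝ y v := by
  have : IsManifold (𝓡 n) 1 M := IsManifold.of_le (n := ∞) (by simp)
  rw [TangentBundle.symmL_trivializationAt (by simpa using hy), coordField]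
  simp only [modelWithCornersSelf_coe, Set.range_id, mfderivWithin_univ]
  rfl

theorem mfderiv_extChartAt_coordField {x y : M} (hy : y ∈ (extChartAt (𝓡 n) x).source)
    (v : EuclideanSpace ℝ (Fin n)) :
    mfderiv (𝓡 n) 𝓘(ℝ, EuclideanSpace ℝ (Fin n)) (extChartAt (𝓡 n) x) y (coordField x v y) = v := by
  have : IsManifold (𝓡 n) 1 M := IsManifold.of_le (n := ∞) (by simp)
  have h := mfderiv_extChartAt_comp_mfderivWithin_extChartAt_symm' (I := 𝓡 n) hy
  simp only [modelWithCornersSelf_coe, Set.range_id, mfderivWithin_univ] at h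
  exact congrArg (fun L : EuclideanSpace ℝ (Fin n) →L[ℝ] EuclideanSpace ℝ (Fin n) ↦ L v) h

theorem coordField_mfderiv_extChartAt {x y : M} (hy : y ∈ (extChartAt (𝓡 n) x).source)
    (w : TangentSpace (𝓡 n) y) :
    coordField x (mfderiv (𝓡 n) 𝓘(ℝ, EuclideanSpace ℝ (Fin n)) (extChartAt (𝓡 n) x) y w) y = w := by
  have : IsManifold (𝓡 n) 1 M := IsManifold.of_le (n := ∞) (by simp)
  have h := mfderivWithin_extChartAt_symm_comp_mfderiv_extChartAt' (I := 𝓡 n) hy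
  simp only [modelWithCornersSelf_coe, Set.range_id, mfderivWithin_univ] at h
  exact congrArg (fun L : EuclideanSpace ℝ (Fin n) →L[ℝ] EuclideanSpace ℝ (Fin n) ↦ L w) h

@[simp]
theorem coordField_self (x : M) (v : EuclideanSpace ℝ (Fin n)) : coordField x v x = v := by
  have h := coordField_mfderiv_extChartAt (mem_extChartAt_source (I := 𝓡 n) x) v
  rwa [mfderiv_extChartAt_self] at h

theorem contMDiffOn_coordField (x : M) (v : EuclideanSpace ℝ (Fin n)) :
    ContMDiffOn (𝓡 n) (𝓡 n).tangent ∞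
      (fun y ↦ (⟨y, coordField x v y⟩ : TangentBundle (𝓡 n) M)) (extChartAt (𝓡 n) x).source := by
  set t := trivializationAt (EuclideanSpace ℝ (Fin n)) (TangentSpace (𝓡 n) : M → Type _) x
  have hs : (extChartAt (𝓡 n) x).source = t.baseSet := by
    simp [t, TangentBundle.trivializationAt_baseSet]
  rw [hs]
  intro y hy
  rw [t.contMDiffWithinAt_section _ hy]
  have : ContMDiffOn (𝓡 n) 𝓘(ℝ, EuclideanSpace ℝ (Fin n)) ∞ (fun _ : M ↦ v) t.baseSet :=
    contMDiffOn_const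
  refine (this.congr fun z hz ↦ ?_) y hy
  rw [coordField_eq_symmL (by rwa [hs])]
  have h := t.continuousLinearMapAt_symmL (R := ℝ) hz v
  exact (congrFun (t.coe_linearMapAt_of_mem (R := ℝ) hz) _).symm.trans h

namespace DForm

theorem inChart_self_apply (α : DForm n M k F) (x : M) (v : Fin k → EuclideanSpace ℝ (Fin n)) :
    α.inChart x (extChartAt (𝓡 n) x x) v = α x v := by
  rw [inChart_extChartAt_apply α (mem_extChartAt_source x)]
  simp

theorem d_apply (α : DForm n M k F) (x : M) (v : Fin (k + 1) → EuclideanSpace ℝ (Fin n)) :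
    α.d x v = extDeriv (α.inChart x) (extChartAt (𝓡 n) x x) v := by
  unfold d
  rw [mfderiv_extChartAt_self]
  rfl

/-- The exterior derivative can be computed in any preferred chart. -/
theorem IsSmooth.d_inChart {α : DForm n M k F} (hα : α.IsSmooth) {x : M}
    {u : EuclideanSpace ℝ (Fin n)} (hu : u ∈ (extChartAt (𝓡 n) x).target) :
    α.d.inChart x u = extDeriv (α.inChart x) u := by
  set y := (extChartAt (𝓡 n) x).symm u with hy
  have hys : y ∈ (extChartAt (𝓡 n) x).source := (extChartAt (𝓡 n) x).map_target hu
  -- At `y` the exterior derivative is defined through the preferred chart of `y`, not of `x`. The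
  -- transition map `τ` relates the two, and `extDeriv` commutes with pullback by it.
  set τ : EuclideanSpace ℝ (Fin n) → EuclideanSpace ℝ (Fin n) :=
    fun z ↦ extChartAt (𝓡 n) y ((extChartAt (𝓡 n) x).symm z) with hτ
  have hτu : τ u = extChartAt (𝓡 n) y y := rfl
  have hmem : ∀ᶠ z in nhds u, z ∈ (extChartAt (𝓡 n) x).target ∧
      (extChartAt (𝓡 n) x).symm z ∈ (extChartAt (𝓡 n) y).source := by
    refine Filter.Eventually.and ((isOpen_extChartAt_target x).mem_nhds hu) ?_
    exact (continuousAt_extChartAt_symm'' hu).preimage_mem_nhds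
      (extChartAt_source_mem_nhds (I := 𝓡 n) y)
  have hτs : ContDiffAt ℝ ∞ τ u := by
    have h1 : ContMDiffAt 𝓘(ℝ, EuclideanSpace ℝ (Fin n)) (𝓡 n) ∞ (extChartAt (𝓡 n) x).symm u :=
      (contMDiffOn_extChartAt_symm x).contMDiffAt ((isOpen_extChartAt_target x).mem_nhds hu)
    have h2 : ContMDiffAt (𝓡 n) 𝓘(ℝ, EuclideanSpace ℝ (Fin n)) ∞ (extChartAt (𝓡 n) y) y :=
      contMDiffAt_extChartAt
    exact (h2.comp u h1).contDiffAt
  have hDτ : ∀ z, z ∈ (extChartAt (𝓡 n) x).target →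
      (extChartAt (𝓡 n) x).symm z ∈ (extChartAt (𝓡 n) y).source → ∀ v,
      fderiv ℝ τ z v = mfderiv (𝓡 n) 𝓘(ℝ, EuclideanSpace ℝ (Fin n)) (extChartAt (𝓡 n) y)
        ((extChartAt (𝓡 n) x).symm z) (coordField x v ((extChartAt (𝓡 n) x).symm z)) := by
    intro z hz hz' v
    have h1 := mfderiv_comp z (mdifferentiableAt_extChartAt_of_mem hz')
      (mdifferentiableAt_extChartAt_symm hz)
    rw [← mfderiv_eq_fderiv]
    unfold coordField
    rw [(extChartAt (𝓡 n) x).right_inv hz]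
    exact congrArg (fun L : EuclideanSpace ℝ (Fin n) →L[ℝ] EuclideanSpace ℝ (Fin n) ↦ L v) h1
  have hpull : α.inChart x =ᶠ[nhds u]
      fun z ↦ (α.inChart y (τ z)).compContinuousLinearMap (fderiv ℝ τ z) := by
    filter_upwards [hmem] with z hz
    ext v
    rw [ContinuousAlternatingMap.compContinuousLinearMap_apply, inChart_extChartAt_apply α hz.2,
      inChart_apply α hz.1]
    congr 1
    funext i
    rw [Function.comp_apply, hDτ z hz.1 hz.2, coordField_mfderiv_extChartAt hz.2]
  have hyt : extChartAt (𝓡 n) y y ∈ (extChartAt (𝓡 n) y).target := mem_extChartAt_target y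
  have hpb := extDeriv_pullback (x := u) (f := τ) (r := ∞)
    (ContDiffAt.differentiableAt (hα.contDiffAt (x := y) (u := τ u) hyt) (by simp)) hτs
    (by simpa using two_le_infty)
  rw [hpull.extDeriv_eq, hpb]
  ext v
  rw [inChart_apply _ hu, ContinuousAlternatingMap.compContinuousLinearMap_apply, hτu]
  refine (d_apply α y _).trans ?_
  congr 1
  funext i
  rw [Function.comp_apply, hDτ u hu (mem_extChartAt_source y), mfderiv_extChartAt_self]
  rfl

theorem IsSmooth.d {α : DForm n M k F} (hα : α.IsSmooth) : α.d.IsSmooth := by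
  intro x
  exact ((hα x).extDeriv (isOpen_extChartAt_target x)).congr fun u hu ↦ hα.d_inChart hu

theorem IsSmooth.d_d {α : DForm n M k F} (hα : α.IsSmooth) : α.d.d = 0 := by
  funext x
  ext v
  have h : α.d.inChart x =ᶠ[nhds (extChartAt (𝓡 n) x x)] extDeriv (α.inChart x) := by
    filter_upwards [(isOpen_extChartAt_target (I := 𝓡 n) x).mem_nhds (mem_extChartAt_target x)]
      with u hu using hα.d_inChart hu
  refine (d_apply _ x v).trans ?_
  rw [h.extDeriv_eq, extDeriv_extDeriv_apply (r := ∞)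
    (hα.contDiffAt (mem_extChartAt_target x)) (by simpa using two_le_infty)]
  rfl

end DForm

end FormsInCharts

/-! ### The square of a two-form -/

/-- Listing the 24 signed permutations makes the alternating sum over `S₄` explicit for
`wedge_self_apply`. -/
theorem sum_perm_fin_four (f : Fin 4 → Fin 4 → Fin 4 → Fin 4 → ℝ) :
    ∑ s : Equiv.Perm (Fin 4), (Equiv.Perm.sign s : ℤ) • f (s 0) (s 1) (s 2) (s 3) =
      f 0 1 2 3 - f 0 1 3 2 - f 0 2 1 3 + f 0 2 3 1 + f 0 3 1 2 - f 0 3 2 1 - f 1 0 2 3 +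
      f 1 0 3 2 + f 1 2 0 3 - f 1 2 3 0 - f 1 3 0 2 + f 1 3 2 0 + f 2 0 1 3 - f 2 0 3 1 -
      f 2 1 0 3 + f 2 1 3 0 + f 2 3 0 1 - f 2 3 1 0 - f 3 0 1 2 + f 3 0 2 1 + f 3 1 0 2 -
      f 3 1 2 0 - f 3 2 0 1 + f 3 2 1 0 := by
  have h : (Finset.univ : Finset (Equiv.Perm (Fin 4))).val.map
      (fun s ↦ ((Equiv.Perm.sign s : ℤ), s 0, s 1, s 2, s 3)) = {
    (1, 0, 1, 2, 3), (-1, 0, 1, 3, 2), (-1, 0, 2, 1, 3), (1, 0, 2, 3, 1), (1, 0, 3, 1, 2),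
    (-1, 0, 3, 2, 1), (-1, 1, 0, 2, 3), (1, 1, 0, 3, 2), (1, 1, 2, 0, 3), (-1, 1, 2, 3,
    0), (-1, 1, 3, 0, 2), (1, 1, 3, 2, 0), (1, 2, 0, 1, 3), (-1, 2, 0, 3, 1), (-1, 2, 1,
    0, 3), (1, 2, 1, 3, 0), (1, 2, 3, 0, 1), (-1, 2, 3, 1, 0), (-1, 3, 0, 1, 2), (1, 3, 0,
    2, 1), (1, 3, 1, 0, 2), (-1, 3, 1, 2, 0), (-1, 3, 2, 0, 1), (1, 3, 2, 1, 0)} := by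
    decide +kernel
  have h1 := congrArg (fun m ↦ (m.map fun t : ℤ × Fin 4 × Fin 4 × Fin 4 × Fin 4 ↦
    t.1 • f t.2.1 t.2.2.1 t.2.2.2.1 t.2.2.2.2).sum) h
  rw [Multiset.map_map] at h1
  refine Eq.trans h1 ?_
  simp only [Multiset.insert_eq_cons, Multiset.map_cons, Multiset.map_singleton,
    Multiset.sum_cons, Multiset.sum_singleton, one_smul, neg_smul]
  ring

section FormsInCharts

variable {n : ℕ} {M : Type*} [TopologicalSpace M] [ChartedSpace (EuclideanSpace ℝ (Fin n)) M]

theorem DForm.two_swap (α : DForm n M 2 ℝ) (x : M) (u v : TangentSpace (𝓡 n) x) :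
    α x ![u, v] = -α x ![v, u] := by
  have h := (α x).toAlternatingMap.map_swap ![v, u] (show (0 : Fin 2) ≠ 1 by decide)
  refine Eq.trans (congrArg (α x) (funext fun i ↦ ?_)) h
  fin_cases i <;> simp

/-- Multiplication by `2! · 2! = 4` turns the sum over shuffles into the sum over all of `S₄`. There
each of the three products occurs eight times, whence the factor `2`. -/
theorem DForm.wedge_self_apply (α : DForm n M 2 ℝ) (x : M) (u v w z : TangentSpace (𝓡 n) x) :
    α.wedge α x ![u, v, w, z] = 2 * (α x ![u, v] * α x ![w, z] - α x ![u, w] * α x ![v, z]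
      + α x ![u, z] * α x ![v, w]) := by
  set a := (α x).toAlternatingMap with ha
  set p : Fin 2 ⊕ Fin 2 → TangentSpace (𝓡 n) x := fun i ↦ ![u, v, w, z] (finSumFinEquiv i) with hp
  have h : MultilinearMap.alternatization (MultilinearMap.domCoprod
      (a : MultilinearMap ℝ (fun _ : Fin 2 ↦ TangentSpace (𝓡 n) x) ℝ)
      (a : MultilinearMap ℝ (fun _ : Fin 2 ↦ TangentSpace (𝓡 n) x) ℝ)) p =
      4 • a.domCoprod a p := by
    rw [MultilinearMap.domCoprod_alternization_eq, Fintype.card_fin]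
    rfl
  have h1 : 4 * α.wedge α x ![u, v, w, z] = ∑ s : Equiv.Perm (Fin 2 ⊕ Fin 2),
      (Equiv.Perm.sign s : ℤ) •
        (a (fun i ↦ p (s (.inl i))) * a (fun i ↦ p (s (.inr i)))) := by
    have h2 : 4 * α.wedge α x ![u, v, w, z] = LinearMap.mul' ℝ ℝ (4 • a.domCoprod a p) := by
      rw [map_nsmul, nsmul_eq_mul]
      rfl
    rw [h2, ← h, MultilinearMap.alternatization_apply, map_sum]
    refine Finset.sum_congr rfl fun s _ ↦ ?_
    exact map_zsmul (LinearMap.mul' ℝ ℝ) _ _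
  have h3 := sum_perm_fin_four fun i j k l ↦
    α x ![![u, v, w, z] i, ![u, v, w, z] j] * α x ![![u, v, w, z] k, ![u, v, w, z] l]
  rw [← (finSumFinEquiv (m := 2) (n := 2)).permCongr.sum_comp] at h3
  have h4 : 4 * α.wedge α x ![u, v, w, z] = _ := h1.trans (Eq.trans
    (Finset.sum_congr rfl fun s _ ↦ by
      rw [Equiv.Perm.sign_permCongr]
      congr 2
      · refine congrArg (α x) (funext fun i ↦ ?_)
        fin_cases i <;> rfl
      · refine congrArg (α x) (funext fun i ↦ ?_)
        fin_cases i <;> rfl) h3)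
  simp at h4
  have s1 := α.two_swap x v u
  have s2 := α.two_swap x w u
  have s3 := α.two_swap x z u
  have s4 := α.two_swap x w v
  have s5 := α.two_swap x z v
  have s6 := α.two_swap x z w
  rw [s1, s2, s3, s4, s5, s6] at h4
  linarith

end FormsInCharts

/-! ### Alternating three-forms as trilinear maps -/

section TrilinearForms

variable {V : Type*} [AddCommGroup V] [Module ℝ V]

/-- An alternating form of degree three as a trilinear map. -/
def AlternatingMap.toTrilinear (f : V [⋀^Fin 3]→ₗ[ℝ] ℝ) : V →ₗ[ℝ] V →ₗ[ℝ] V →ₗ[ℝ] ℝ :=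
  LinearMap.mk₂ ℝ
    (fun u v ↦
      { toFun := fun w ↦ ((f.curryLeft u).curryLeft v).curryLeft w ![]
        map_add' := fun _ _ ↦ by simp only [map_add, AlternatingMap.add_apply]
        map_smul' := fun _ _ ↦ by simp only [map_smul, AlternatingMap.smul_apply]; rfl })
    (fun _ _ _ ↦ LinearMap.ext fun _ ↦ by
      simp only [map_add, AlternatingMap.curryLeft_add, AlternatingMap.add_apply, LinearMap.add_apply]; rfl)
    (fun _ _ _ ↦ LinearMap.ext fun _ ↦ by
      simp only [map_smul, AlternatingMap.curryLeft_smul, AlternatingMap.smul_apply, LinearMap.smul_apply]; rfl)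
    (fun _ _ _ ↦ LinearMap.ext fun _ ↦ by
      simp only [map_add, AlternatingMap.curryLeft_add, AlternatingMap.add_apply, LinearMap.add_apply]; rfl)
    (fun _ _ _ ↦ LinearMap.ext fun _ ↦ by
      simp only [map_smul, AlternatingMap.curryLeft_smul, AlternatingMap.smul_apply, LinearMap.smul_apply]; rfl)

end TrilinearForms

/-! ### Functions and vector fields in charts -/

section ChartExpressions

variable {n : ℕ} {M : Type*} [TopologicalSpace M] [ChartedSpace (EuclideanSpace ℝ (Fin n)) M]

/-- For a function on a manifold, the differential at the centre of a chart. -/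
theorem mvfderiv_eq_fderiv_extChartAt {f : M → ℝ} {x : M} (hf : MDifferentiableAt (𝓡 n) 𝓘(ℝ, ℝ) f x)
    (v : EuclideanSpace ℝ (Fin n)) : mvfderiv (𝓡 n) f x v =
      fderiv ℝ (fun u ↦ f ((extChartAt (𝓡 n) x).symm u)) (extChartAt (𝓡 n) x x) v := by
  simp only [mvfderiv, mfderiv, hf, writtenInExtChartAt,
    modelWithCornersSelf_coe, Set.range_id, fderivWithin_univ]
  rfl

variable [IsManifold (𝓡 n) ∞ M]

/-- The expression of a smooth vector field in a chart is smooth. -/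
theorem contDiffOn_mfderiv_extChartAt_apply {x : M} {Y : Π y : M, TangentSpace (𝓡 n) y}
    (hY : ContMDiffOn (𝓡 n) (𝓡 n).tangent ∞ (fun y ↦ (⟨y, Y y⟩ : TangentBundle (𝓡 n) M))
      (extChartAt (𝓡 n) x).source) :
    ContDiffOn ℝ ∞ (fun u ↦ (mfderiv (𝓡 n) 𝓘(ℝ, EuclideanSpace ℝ (Fin n)) (extChartAt (𝓡 n) x)
      ((extChartAt (𝓡 n) x).symm u) (Y ((extChartAt (𝓡 n) x).symm u)) : EuclideanSpace ℝ (Fin n)))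
      (extChartAt (𝓡 n) x).target := by
  have : IsManifold (𝓡 n) 1 M := IsManifold.of_le (n := ∞) (by simp)
  set t := trivializationAt (EuclideanSpace ℝ (Fin n)) (TangentSpace (𝓡 n) : M → Type _) x
  have hs : (extChartAt (𝓡 n) x).source = t.baseSet := by
    simp [t, TangentBundle.trivializationAt_baseSet]
  have h1 : ContMDiffOn (𝓡 n) 𝓘(ℝ, EuclideanSpace ℝ (Fin n)) ∞
      (fun y ↦ (t ⟨y, Y y⟩).2) (extChartAt (𝓡 n) x).source := by
    rw [hs] at hY ⊢
    intro y hy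
    exact (t.contMDiffWithinAt_section _ hy).1 (hY y hy)
  have h2 := h1.comp (contMDiffOn_extChartAt_symm (I := 𝓡 n) (n := ∞) x) fun u hu ↦
    (extChartAt (𝓡 n) x).map_target hu
  refine (contMDiffOn_iff_contDiffOn.1 h2).congr fun u hu ↦ ?_
  have hu' := (extChartAt (𝓡 n) x).map_target hu
  rw [← TangentBundle.continuousLinearMapAt_trivializationAt (by simpa using hu')]
  exact congrFun (t.coe_linearMapAt_of_mem (R := ℝ) (by rwa [← hs])) _

theorem mdifferentiableAt_coordField (x : M) (v : EuclideanSpace ℝ (Fin n)) :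
    MDifferentiableAt (𝓡 n) (𝓡 n).tangent
      (fun y ↦ (⟨y, coordField x v y⟩ : TangentBundle (𝓡 n) M)) x :=
  ((contMDiffOn_coordField x v).contMDiffAt
    (extChartAt_source_mem_nhds (I := 𝓡 n) x)).mdifferentiableAt (by simp)

/-- Coordinate vector fields commute. -/
theorem mlieBracket_coordField (x : M) (v w : EuclideanSpace ℝ (Fin n)) :
    VectorField.mlieBracket (𝓡 n) (coordField x v) (coordField x w) x = 0 := by
  have hc : ∀ v : EuclideanSpace ℝ (Fin n),
      VectorField.mpullbackWithin 𝓘(ℝ, EuclideanSpace ℝ (Fin n)) (𝓡 n) (extChartAt (𝓡 n) x).symm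
        (coordField x v) (Set.range (𝓡 n)) =ᶠ[nhds (extChartAt (𝓡 n) x x)] fun _ ↦ v := by
    intro v
    have : IsManifold (𝓡 n) 1 M := IsManifold.of_le (n := ∞) (by simp)
    filter_upwards [(isOpen_extChartAt_target (I := 𝓡 n) x).mem_nhds (mem_extChartAt_target x)]
      with u hu
    rw [VectorField.mpullbackWithin_apply]
    have hinv := isInvertible_mfderivWithin_extChartAt_symm (I := 𝓡 n) hu
    have h : coordField x v ((extChartAt (𝓡 n) x).symm u) =
        mfderivWithin 𝓘(ℝ, EuclideanSpace ℝ (Fin n)) (𝓡 n) (extChartAt (𝓡 n) x).symm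
          (Set.range (𝓡 n)) u v := by
      simp only [coordField, modelWithCornersSelf_coe, Set.range_id, mfderivWithin_univ]
      rw [(extChartAt (𝓡 n) x).right_inv hu]
    rw [h]
    exact hinv.inverse_apply_eq.2 rfl
  rw [← VectorField.mlieBracketWithin_univ, VectorField.mlieBracketWithin_apply,
    Filter.EventuallyEq.lieBracketWithin_vectorField_eq_nhds (hc v) (hc w)]
  have h (s : Set (EuclideanSpace ℝ (Fin n))) (c : EuclideanSpace ℝ (Fin n)) :
      VectorField.lieBracketWithin ℝ (fun _ ↦ v) (fun _ ↦ w) s c = 0 := by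
    simp [VectorField.lieBracketWithin]
  rw [h]
  exact ContinuousLinearMap.map_zero _

end ChartExpressions

/-! ### The metric, `J` and `σ` in charts -/

section AlmostHermitianCharts

variable {n : ℕ} {M : Type*} [TopologicalSpace M] [ChartedSpace (EuclideanSpace ℝ (Fin n)) M]
  [IsManifold (𝓡 n) ∞ M] (S : AlmostHermitian n M)

namespace AlmostHermitian

/-- The metric as a bilinear form on a tangent space. -/
noncomputable def gLin (x : M) :
    TangentSpace (𝓡 n) x →ₗ[ℝ] TangentSpace (𝓡 n) x →ₗ[ℝ] ℝ :=
  LinearMap.mk₂ ℝ (fun u v ↦ S.g.inner x u v) (fun _ _ _ ↦ by simp) (fun _ _ _ ↦ by simp)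
    (fun _ _ _ ↦ by simp) (fun _ _ _ ↦ by simp)

/-- The almost complex structure as an endomorphism of a tangent space. -/
noncomputable def jLin (x : M) : TangentSpace (𝓡 n) x →ₗ[ℝ] TangentSpace (𝓡 n) x := S.J x

theorem isHermitian (x : M) : IsHermitian (S.gLin x) (S.jLin x) where
  symm := S.g.symm x
  pos := S.g.pos x
  J_J := S.J_J x
  g_J_J := S.g_J_J x

theorem σ_apply (x : M) (u v : TangentSpace (𝓡 n) x) : S.σ x ![u, v] = S.gLin x (S.jLin x u) v :=
  rfl

/-- The metric in a chart. -/
noncomputable def metricInChart (x : M) (u : EuclideanSpace ℝ (Fin n)) :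
    EuclideanSpace ℝ (Fin n) →L[ℝ] EuclideanSpace ℝ (Fin n) →L[ℝ] ℝ :=
  let L : EuclideanSpace ℝ (Fin n) →L[ℝ] EuclideanSpace ℝ (Fin n) :=
    mfderiv 𝓘(ℝ, EuclideanSpace ℝ (Fin n)) (𝓡 n) (extChartAt (𝓡 n) x).symm u
  let G : EuclideanSpace ℝ (Fin n) →L[ℝ] EuclideanSpace ℝ (Fin n) →L[ℝ] ℝ :=
    S.g.inner ((extChartAt (𝓡 n) x).symm u)
  G.bilinearComp L L

/-- The almost complex structure in a chart. -/
noncomputable def jInChart (x : M) (u : EuclideanSpace ℝ (Fin n)) :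
    EuclideanSpace ℝ (Fin n) →L[ℝ] EuclideanSpace ℝ (Fin n) :=
  let L : EuclideanSpace ℝ (Fin n) →L[ℝ] EuclideanSpace ℝ (Fin n) :=
    mfderiv 𝓘(ℝ, EuclideanSpace ℝ (Fin n)) (𝓡 n) (extChartAt (𝓡 n) x).symm u
  let J' : EuclideanSpace ℝ (Fin n) →L[ℝ] EuclideanSpace ℝ (Fin n) :=
    S.J ((extChartAt (𝓡 n) x).symm u)
  let L' : EuclideanSpace ℝ (Fin n) →L[ℝ] EuclideanSpace ℝ (Fin n) :=
    mfderiv (𝓡 n) 𝓘(ℝ, EuclideanSpace ℝ (Fin n)) (extChartAt (𝓡 n) x)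
      ((extChartAt (𝓡 n) x).symm u)
  L' ∘L J' ∘L L

theorem metricInChart_apply {x : M} {u : EuclideanSpace ℝ (Fin n)}
    (hu : u ∈ (extChartAt (𝓡 n) x).target) (v w : EuclideanSpace ℝ (Fin n)) :
    S.metricInChart x u v w = S.g.inner ((extChartAt (𝓡 n) x).symm u)
      (coordField x v ((extChartAt (𝓡 n) x).symm u))
      (coordField x w ((extChartAt (𝓡 n) x).symm u)) := by
  simp only [coordField]
  rw [(extChartAt (𝓡 n) x).right_inv hu]
  rfl

theorem jInChart_apply {x : M} {u : EuclideanSpace ℝ (Fin n)}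
    (hu : u ∈ (extChartAt (𝓡 n) x).target) (v : EuclideanSpace ℝ (Fin n)) :
    S.jInChart x u v = mfderiv (𝓡 n) 𝓘(ℝ, EuclideanSpace ℝ (Fin n)) (extChartAt (𝓡 n) x)
      ((extChartAt (𝓡 n) x).symm u) (S.J ((extChartAt (𝓡 n) x).symm u)
        (coordField x v ((extChartAt (𝓡 n) x).symm u))) := by
  simp only [coordField]
  rw [(extChartAt (𝓡 n) x).right_inv hu]
  rfl

theorem coordField_jInChart {x : M} {u : EuclideanSpace ℝ (Fin n)}
    (hu : u ∈ (extChartAt (𝓡 n) x).target) (v : EuclideanSpace ℝ (Fin n)) :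
    coordField x (S.jInChart x u v) ((extChartAt (𝓡 n) x).symm u) =
      S.J ((extChartAt (𝓡 n) x).symm u) (coordField x v ((extChartAt (𝓡 n) x).symm u)) := by
  rw [jInChart_apply S hu, coordField_mfderiv_extChartAt ((extChartAt (𝓡 n) x).map_target hu)]

theorem jInChart_self (x : M) (v : EuclideanSpace ℝ (Fin n)) :
    S.jInChart x (extChartAt (𝓡 n) x x) v = S.J x v := by
  have h := S.coordField_jInChart (mem_extChartAt_target (I := 𝓡 n) x) v
  have h0 := extChartAt_to_inv (I := 𝓡 n) x
  -- The inverse chart at the centre is only propositionally equal to `x`; with this point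
  -- generalised to `y`, the equality can be substituted in the dependent types.
  have h1 : ∀ y : M, y = x → (coordField x (S.jInChart x (extChartAt (𝓡 n) x x) v) y :
      EuclideanSpace ℝ (Fin n)) = S.J y (coordField x v y) →
      S.jInChart x (extChartAt (𝓡 n) x x) v = S.J x v := by
    rintro y rfl h
    rw [coordField_self, coordField_self] at h
    exact h
  exact h1 _ h0 h

theorem metricInChart_self (x : M) (v w : EuclideanSpace ℝ (Fin n)) :
    S.metricInChart x (extChartAt (𝓡 n) x x) v w = S.g.inner x v w := by
  have h := S.metricInChart_apply (mem_extChartAt_target (I := 𝓡 n) x) v w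
  have h0 := extChartAt_to_inv (I := 𝓡 n) x
  have h1 : ∀ y : M, y = x → S.metricInChart x (extChartAt (𝓡 n) x x) v w =
      S.g.inner y (coordField x v y) (coordField x w y) →
      S.metricInChart x (extChartAt (𝓡 n) x x) v w = S.g.inner x v w := by
    rintro y rfl h
    simpa using h
  exact h1 _ h0 h

theorem jInChart_jInChart {x : M} {u : EuclideanSpace ℝ (Fin n)}
    (hu : u ∈ (extChartAt (𝓡 n) x).target) (v : EuclideanSpace ℝ (Fin n)) :
    S.jInChart x u (S.jInChart x u v) = -v := by
  rw [jInChart_apply S hu, coordField_jInChart S hu, S.J_J, map_neg,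
    mfderiv_extChartAt_coordField ((extChartAt (𝓡 n) x).map_target hu)]
  rfl

theorem contMDiffOn_J_coordField (x : M) (v : EuclideanSpace ℝ (Fin n)) :
    ContMDiffOn (𝓡 n) (𝓡 n).tangent ∞
      (fun y ↦ (⟨y, S.J y (coordField x v y)⟩ : TangentBundle (𝓡 n) M))
      (extChartAt (𝓡 n) x).source :=
  ContMDiffOn.clm_bundle_apply (F₁ := EuclideanSpace ℝ (Fin n)) (F₂ := EuclideanSpace ℝ (Fin n))
    S.contMDiff_J.contMDiffOn (contMDiffOn_coordField x v)

theorem contDiffOn_jInChart (x : M) :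
    ContDiffOn ℝ ∞ (S.jInChart x) (extChartAt (𝓡 n) x).target := by
  rw [contDiffOn_clm_apply]
  intro v
  exact (contDiffOn_mfderiv_extChartAt_apply (S.contMDiffOn_J_coordField x v)).congr
    fun u hu ↦ S.jInChart_apply hu v

theorem contDiffOn_metricInChart (x : M) :
    ContDiffOn ℝ ∞ (S.metricInChart x) (extChartAt (𝓡 n) x).target := by
  rw [contDiffOn_clm_apply]
  intro v
  rw [contDiffOn_clm_apply]
  intro w
  have h : ContMDiffOn (𝓡 n) ((𝓡 n).prod 𝓘(ℝ, ℝ)) ∞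
      (fun y ↦ TotalSpace.mk' ℝ (E := Bundle.Trivial M ℝ) y
        (S.g.inner y (coordField x v y) (coordField x w y))) (extChartAt (𝓡 n) x).source :=
    ContMDiffOn.clm_bundle_apply₂ (F₁ := EuclideanSpace ℝ (Fin n)) (F₂ := EuclideanSpace ℝ (Fin n))
      S.g.contMDiff.contMDiffOn (contMDiffOn_coordField x v) (contMDiffOn_coordField x w)
  have h' : ContMDiffOn (𝓡 n) 𝓘(ℝ, ℝ) ∞
      (fun y ↦ S.g.inner y (coordField x v y) (coordField x w y)) (extChartAt (𝓡 n) x).source := by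
    intro y hy
    have := h y hy
    rw [contMDiffWithinAt_totalSpace] at this
    exact this.2
  exact (contMDiffOn_iff_contDiffOn.1 (h'.comp (contMDiffOn_extChartAt_symm (I := 𝓡 n) (n := ∞) x)
    fun u hu ↦ (extChartAt (𝓡 n) x).map_target hu)).congr fun u hu ↦ S.metricInChart_apply hu v w

theorem σ_inChart_apply {x : M} {u : EuclideanSpace ℝ (Fin n)}
    (hu : u ∈ (extChartAt (𝓡 n) x).target) (v : Fin 2 → EuclideanSpace ℝ (Fin n)) :
    S.σ.inChart x u v = S.metricInChart x u (S.jInChart x u (v 0)) (v 1) := by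
  rw [DForm.inChart_apply _ hu, metricInChart_apply S hu, coordField_jInChart S hu]
  rfl

theorem isSmooth_σ : S.σ.IsSmooth := by
  intro x
  refine contDiffOn_continuousAlternatingMap_of_apply fun v ↦ ?_
  refine ContDiffOn.congr ?_ fun u hu ↦ S.σ_inChart_apply hu v
  exact ((S.contDiffOn_metricInChart x).clm_apply
    ((S.contDiffOn_jInChart x).clm_apply contDiffOn_const)).clm_apply contDiffOn_const

end AlmostHermitian

end AlmostHermitianCharts

/-! ### Product rules for `J` and the metric -/

section FiberwiseProducts

variable {E : Type*} [NormedAddCommGroup E] [NormedSpace ℝ E]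

/-- The derivative of `j (j v) = -v`. The vector `v'` is the value of `j v` at `p` held fixed, so
only the outer factor is differentiated on the left. -/
theorem fderiv_apply_apply_of_involutive {j : E → E →L[ℝ] E} {p : E} (hj : DifferentiableAt ℝ j p)
    {v v' : E} (h : ∀ᶠ z in nhds p, j z (j z v) = -v) (hv : j p v = v') (u : E) :
    fderiv ℝ (fun z ↦ j z v') p u = -j p (fderiv ℝ (fun z ↦ j z v) p u) := by
  subst hv
  have h1 := hj.hasFDerivAt.clm_apply (hj.clm_apply (differentiableAt_const v)).hasFDerivAt
  have h2 := h1.unique ((hasFDerivAt_const (-v) p).congr_of_eventuallyEq h)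
  have h3 := (hj.hasFDerivAt.clm_apply (hasFDerivAt_const (j p v) p)).fderiv
  have h4 := congrArg (fun L : E →L[ℝ] E ↦ L u) h2
  rw [h3]
  simp at h4 ⊢
  exact eq_neg_of_add_eq_zero_right h4

theorem fderiv_bilinear_apply {G : E → E →L[ℝ] E →L[ℝ] ℝ} {j : E → E →L[ℝ] E} {s : E → ℝ} {p : E}
    (hG : DifferentiableAt ℝ G p) (hj : DifferentiableAt ℝ j p)
    {v v' w : E} (hs : ∀ᶠ z in nhds p, s z = G z (j z v) w) (hv : j p v = v') (u : E) :
    fderiv ℝ s p u = fderiv ℝ (fun z ↦ G z v' w) p u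
      + G p (fderiv ℝ (fun z ↦ j z v) p u) w := by
  subst hv
  have h := ((hG.hasFDerivAt.clm_apply (hj.clm_apply (differentiableAt_const v)).hasFDerivAt)).clm_apply
    (hasFDerivAt_const w p)
  have h' := (hG.hasFDerivAt.clm_apply (hasFDerivAt_const (j p v) p)).clm_apply
    (hasFDerivAt_const w p)
  rw [Filter.EventuallyEq.fderiv_eq hs, h.fderiv, h'.fderiv]
  simp [add_comm]

end FiberwiseProducts

/-! ### The covariant derivative of `J` and its symmetries -/

section CovariantDerivativeOfJ

variable {n : ℕ} {M : Type*} [TopologicalSpace M] [ChartedSpace (EuclideanSpace ℝ (Fin n)) M]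
  [IsManifold (𝓡 n) ∞ M] (S : AlmostHermitian n M)

theorem coordField_apply_self (x : M) (v : TangentSpace (𝓡 n) x) :
    (coordField x v x : TangentSpace (𝓡 n) x) = v :=
  coordField_self x v

namespace AlmostHermitian

/-- The Christoffel symbol at the centre of a chart. -/
noncomputable def christoffel (x : M) (u v : TangentSpace (𝓡 n) x) : TangentSpace (𝓡 n) x :=
  leviCivita S.g (coordField x v) x u

/-- The derivative of `J` along coordinate vector fields at the centre of a chart. -/
noncomputable def partialJ (x : M) (u v : TangentSpace (𝓡 n) x) : TangentSpace (𝓡 n) x :=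
  fderiv ℝ (fun z ↦ S.jInChart x z v) (extChartAt (𝓡 n) x x) u

/-- The covariant derivative `(∇_u J) v` as a tensor. -/
noncomputable def nablaJAt (x : M) (u v : TangentSpace (𝓡 n) x) : TangentSpace (𝓡 n) x :=
  leviCivita S.g (fun y ↦ S.J y (coordField x v y)) x u - S.jLin x (S.christoffel x u v)

theorem mdifferentiableAt_J {Y : Π x : M, TangentSpace (𝓡 n) x} {x : M}
    (hY : MDifferentiableAt (𝓡 n) (𝓡 n).tangent
      (fun y ↦ (⟨y, Y y⟩ : TangentBundle (𝓡 n) M)) x) :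
    MDifferentiableAt (𝓡 n) (𝓡 n).tangent
      (fun y ↦ (⟨y, S.J y (Y y)⟩ : TangentBundle (𝓡 n) M)) x :=
  MDifferentiableAt.clm_bundle_apply (F₁ := EuclideanSpace ℝ (Fin n))
    (F₂ := EuclideanSpace ℝ (Fin n)) (S.contMDiff_J.mdifferentiableAt (by simp)) hY

theorem leviCivita_metric {Y Z : Π x : M, TangentSpace (𝓡 n) x} {x : M}
    (hY : MDifferentiableAt (𝓡 n) (𝓡 n).tangent (fun y ↦ (⟨y, Y y⟩ : TangentBundle (𝓡 n) M)) x)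
    (hZ : MDifferentiableAt (𝓡 n) (𝓡 n).tangent (fun y ↦ (⟨y, Z y⟩ : TangentBundle (𝓡 n) M)) x)
    (u : TangentSpace (𝓡 n) x) :
    mvfderiv (𝓡 n) (fun y ↦ S.g.inner y (Y y) (Z y)) x u =
      S.gLin x (leviCivita S.g Y x u) (Z x) + S.gLin x (Y x) (leviCivita S.g Z x u) := by
  have h := (isLeviCivita_leviCivita S.g).1 (coordField x u) Y Z x hY hZ
  rwa [coordField_apply_self] at h

theorem christoffel_symm (x : M) (u v : TangentSpace (𝓡 n) x) :
    S.christoffel x u v = S.christoffel x v u := by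
  have h := (isLeviCivita_leviCivita S.g).2
  rw [CovariantDerivative.torsion_eq_zero_iff] at h
  have h1 := h (mdifferentiableAt_coordField x u) (mdifferentiableAt_coordField x v)
  rw [coordField_apply_self, coordField_apply_self] at h1
  exact sub_eq_zero.1 (h1.trans (mlieBracket_coordField x u v))

theorem christoffel_neg_right (x : M) (u v : TangentSpace (𝓡 n) x) :
    S.christoffel x u (-v) = -S.christoffel x u v := by
  rw [christoffel_symm, christoffel_symm S x u]
  exact map_neg _ _

theorem fderiv_metricInChart (x : M) (u v w : TangentSpace (𝓡 n) x) :
    fderiv ℝ (fun z ↦ S.metricInChart x z v w) (extChartAt (𝓡 n) x x) u =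
      S.gLin x (S.christoffel x u v) w + S.gLin x v (S.christoffel x u w) := by
  have hv := mdifferentiableAt_coordField x v
  have hw := mdifferentiableAt_coordField x w
  have h := S.leviCivita_metric hv hw u
  rw [coordField_apply_self, coordField_apply_self] at h
  refine Eq.trans ?_ ((mvfderiv_eq_fderiv_extChartAt (mdifferentiableAt_inner S.g hv hw)
    u).symm.trans h)
  refine congrArg (fun L : EuclideanSpace ℝ (Fin n) →L[ℝ] ℝ ↦ L u) (Filter.EventuallyEq.fderiv_eq ?_)
  filter_upwards [(isOpen_extChartAt_target (I := 𝓡 n) x).mem_nhds (mem_extChartAt_target x)]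
    with z hz using S.metricInChart_apply hz v w

theorem fderiv_σ_inChart (x : M) (u v w : TangentSpace (𝓡 n) x) :
    fderiv ℝ (fun z ↦ S.σ.inChart x z ![v, w]) (extChartAt (𝓡 n) x x) u =
      S.gLin x (leviCivita S.g (fun y ↦ S.J y (coordField x v y)) x u) w
        + S.gLin x (S.jLin x v) (S.christoffel x u w) := by
  have hv := S.mdifferentiableAt_J (mdifferentiableAt_coordField x v)
  have hw := mdifferentiableAt_coordField x w
  have h := S.leviCivita_metric hv hw u
  rw [coordField_apply_self, coordField_apply_self] at h
  refine Eq.trans ?_ ((mvfderiv_eq_fderiv_extChartAt (mdifferentiableAt_inner S.g hv hw)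
    u).symm.trans h)
  refine congrArg (fun L : EuclideanSpace ℝ (Fin n) →L[ℝ] ℝ ↦ L u) (Filter.EventuallyEq.fderiv_eq ?_)
  filter_upwards [(isOpen_extChartAt_target (I := 𝓡 n) x).mem_nhds (mem_extChartAt_target x)]
    with z hz
  exact DForm.inChart_apply S.σ hz ![v, w]

theorem differentiableAt_jInChart (x : M) :
    DifferentiableAt ℝ (S.jInChart x) (extChartAt (𝓡 n) x x) :=
  ((S.contDiffOn_jInChart x).contDiffAt ((isOpen_extChartAt_target x).mem_nhds
    (mem_extChartAt_target x))).differentiableAt (by simp)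

theorem differentiableAt_metricInChart (x : M) :
    DifferentiableAt ℝ (S.metricInChart x) (extChartAt (𝓡 n) x x) :=
  ((S.contDiffOn_metricInChart x).contDiffAt ((isOpen_extChartAt_target x).mem_nhds
    (mem_extChartAt_target x))).differentiableAt (by simp)

theorem partialJ_J (x : M) (u v : TangentSpace (𝓡 n) x) :
    S.partialJ x u (S.jLin x v) = -S.jLin x (S.partialJ x u v) := by
  have h := fderiv_apply_apply_of_involutive (S.differentiableAt_jInChart x) (v := v) (by
    filter_upwards [(isOpen_extChartAt_target (I := 𝓡 n) x).mem_nhds (mem_extChartAt_target x)]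
      with z hz using S.jInChart_jInChart hz v)
    (S.jInChart_self x v) u
  rw [jInChart_self] at h
  exact h

theorem fderiv_σ_inChart' (x : M) (u v w : TangentSpace (𝓡 n) x) :
    fderiv ℝ (fun z ↦ S.σ.inChart x z ![v, w]) (extChartAt (𝓡 n) x x) u =
      fderiv ℝ (fun z ↦ S.metricInChart x z (S.jLin x v) w) (extChartAt (𝓡 n) x x) u
        + S.gLin x (S.partialJ x u v) w := by
  have h := fderiv_bilinear_apply (S.differentiableAt_metricInChart x)
    (S.differentiableAt_jInChart x) (v := v) (w := w)
    (s := fun z ↦ S.σ.inChart x z ![v, w]) (by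
      filter_upwards [(isOpen_extChartAt_target (I := 𝓡 n) x).mem_nhds (mem_extChartAt_target x)]
        with z hz using S.σ_inChart_apply hz ![v, w])
    (S.jInChart_self x v) u
  exact h.trans (congrArg _ (S.metricInChart_self x _ w))

/-- The derivative of `σ(v, w)` is computed twice, by metric compatibility applied to `J ∂_v` and by
the product rule in the chart. The metric is nondegenerate, so comparison determines the derivative
of `J`. -/
theorem partialJ_eq (x : M) (u v : TangentSpace (𝓡 n) x) :
    S.partialJ x u v = S.nablaJAt x u v + S.jLin x (S.christoffel x u v)
      - S.christoffel x u (S.jLin x v) := by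
  refine (S.isHermitian x).eq_of_inner_eq fun w ↦ ?_
  have h1 := (S.fderiv_σ_inChart' x u v w).symm.trans (S.fderiv_σ_inChart x u v w)
  rw [fderiv_metricInChart] at h1
  simp only [nablaJAt, map_add, map_sub, LinearMap.add_apply, LinearMap.sub_apply]
  linarith

/-- This is the derivative of `J² = -1`: in `partialJ_J` the Christoffel terms cancel. -/
theorem nablaJAt_J (x : M) (u v : TangentSpace (𝓡 n) x) :
    S.nablaJAt x u (S.jLin x v) = -S.jLin x (S.nablaJAt x u v) := by
  have h := S.partialJ_J x u v
  rw [partialJ_eq, partialJ_eq] at h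
  simp only [map_add, map_sub, (S.isHermitian x).J_J, christoffel_neg_right] at h
  have h' : S.nablaJAt x u (S.jLin x v) = -(S.jLin x (S.nablaJAt x u v)
      + -S.christoffel x u v - S.jLin x (S.christoffel x u (S.jLin x v)))
      - S.jLin x (S.christoffel x u (S.jLin x v)) + -S.christoffel x u v := by
    rw [← h]; abel
  rw [h']; abel

theorem fderiv_σ_inChart_eq (x : M) (u v w : TangentSpace (𝓡 n) x) :
    fderiv ℝ (fun z ↦ S.σ.inChart x z ![v, w]) (extChartAt (𝓡 n) x x) u =
      S.gLin x (S.nablaJAt x u v) w + S.gLin x (S.jLin x (S.christoffel x u v)) w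
        + S.gLin x (S.jLin x v) (S.christoffel x u w) := by
  rw [fderiv_σ_inChart, nablaJAt, map_sub, LinearMap.sub_apply]
  ring

/-- This is the derivative of the skewness of `σ`; the Christoffel terms cancel because `J` is skew
for `g`. -/
theorem nablaJAt_skew (x : M) (u v w : TangentSpace (𝓡 n) x) :
    S.gLin x (S.nablaJAt x u v) w = -S.gLin x (S.nablaJAt x u w) v := by
  have h1 := S.fderiv_σ_inChart_eq x u v w
  have h2 := S.fderiv_σ_inChart_eq x u w v
  have h3 : (fun z ↦ S.σ.inChart x z ![v, w]) = fun z ↦ -S.σ.inChart x z ![w, v] := by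
    funext z
    have h := (S.σ.inChart x z).toAlternatingMap.map_swap ![w, v] (show (0 : Fin 2) ≠ 1 by decide)
    refine Eq.trans (congrArg (S.σ.inChart x z) (funext fun i ↦ ?_)) h
    fin_cases i <;> rfl
  rw [h3, fderiv_fun_neg] at h1
  have h4 := (S.isHermitian x).g_J_left (S.christoffel x u v) w
  have h5 := (S.isHermitian x).g_J_left (S.christoffel x u w) v
  have h6 := (S.isHermitian x).symm (S.jLin x v) (S.christoffel x u w)
  have h7 := (S.isHermitian x).symm (S.jLin x w) (S.christoffel x u v)
  have h8 : -(fderiv ℝ (fun z ↦ S.σ.inChart x z ![w, v]) (extChartAt (𝓡 n) x x) u) = _ := h1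
  linarith

end AlmostHermitian

end CovariantDerivativeOfJ

/-! ### Exterior derivatives in low degree, `dσ` and the Nijenhuis tensor -/

section LowDegree

variable {E : Type*} [NormedAddCommGroup E] [NormedSpace ℝ E]

theorem extDeriv_apply_two {α : E → E [⋀^Fin 2]→L[ℝ] ℝ} {p : E} (hα : DifferentiableAt ℝ α p)
    (u v w : E) : extDeriv α p ![u, v, w] = fderiv ℝ (fun z ↦ α z ![v, w]) p u
      - fderiv ℝ (fun z ↦ α z ![u, w]) p v + fderiv ℝ (fun z ↦ α z ![u, v]) p w := by
  rw [extDeriv_apply hα, Fin.sum_univ_three]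
  have h0 : Fin.removeNth 0 ![u, v, w] = ![v, w] := by ext i; fin_cases i <;> rfl
  have h1 : Fin.removeNth 1 ![u, v, w] = ![u, w] := by ext i; fin_cases i <;> rfl
  have h2 : Fin.removeNth 2 ![u, v, w] = ![u, v] := by ext i; fin_cases i <;> rfl
  rw [h0, h1, h2]
  simp
  ring

theorem extDeriv_apply_three {α : E → E [⋀^Fin 3]→L[ℝ] ℝ} {p : E} (hα : DifferentiableAt ℝ α p)
    (u v w z : E) : extDeriv α p ![u, v, w, z] = fderiv ℝ (fun y ↦ α y ![v, w, z]) p u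
      - fderiv ℝ (fun y ↦ α y ![u, w, z]) p v + fderiv ℝ (fun y ↦ α y ![u, v, z]) p w
      - fderiv ℝ (fun y ↦ α y ![u, v, w]) p z := by
  rw [extDeriv_apply hα, Fin.sum_univ_four]
  have h0 : Fin.removeNth 0 ![u, v, w, z] = ![v, w, z] := by ext i; fin_cases i <;> rfl
  have h1 : Fin.removeNth 1 ![u, v, w, z] = ![u, w, z] := by ext i; fin_cases i <;> rfl
  have h2 : Fin.removeNth 2 ![u, v, w, z] = ![u, v, z] := by ext i; fin_cases i <;> rfl
  have h3 : Fin.removeNth 3 ![u, v, w, z] = ![u, v, w] := by ext i; fin_cases i <;> rfl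
  rw [h0, h1, h2, h3]
  simp
  ring

end LowDegree

section ExteriorDerivativeInCharts

variable {n : ℕ} {M : Type*} [TopologicalSpace M] [ChartedSpace (EuclideanSpace ℝ (Fin n)) M]
  [IsManifold (𝓡 n) ∞ M]

namespace DForm

theorem IsSmooth.differentiableAt {k : ℕ} {F : Type*} [NormedAddCommGroup F] [NormedSpace ℝ F]
    {α : DForm n M k F} (hα : α.IsSmooth) (x : M) :
    DifferentiableAt ℝ (α.inChart x) (extChartAt (𝓡 n) x x) :=
  (hα.contDiffAt (mem_extChartAt_target x)).differentiableAt (by simp)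

theorem IsSmooth.d_apply_two {α : DForm n M 2 ℝ} (hα : α.IsSmooth) (x : M)
    (u v w : EuclideanSpace ℝ (Fin n)) : α.d x ![u, v, w] =
      fderiv ℝ (fun z ↦ α.inChart x z ![v, w]) (extChartAt (𝓡 n) x x) u
      - fderiv ℝ (fun z ↦ α.inChart x z ![u, w]) (extChartAt (𝓡 n) x x) v
      + fderiv ℝ (fun z ↦ α.inChart x z ![u, v]) (extChartAt (𝓡 n) x x) w := by
  exact (d_apply α x _).trans (extDeriv_apply_two (hα.differentiableAt x) u v w)

end DForm

namespace AlmostHermitian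

variable (S : AlmostHermitian n M)

/-- Since the connection is torsion free, `dσ` is the alternation of `∇σ`: the symmetric Christoffel
terms drop out. -/
theorem d_σ_apply (x : M) (u v w : TangentSpace (𝓡 n) x) : S.σ.d x ![u, v, w] =
    S.gLin x (S.nablaJAt x u v) w + S.gLin x (S.nablaJAt x v w) u
      + S.gLin x (S.nablaJAt x w u) v := by
  refine (S.isSmooth_σ.d_apply_two x u v w).trans ?_
  have h1 := S.fderiv_σ_inChart_eq x u v w
  have h2 := S.fderiv_σ_inChart_eq x v u w
  have h3 := S.fderiv_σ_inChart_eq x w u v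
  have k := S.nablaJAt_skew x v u w
  rw [S.christoffel_symm x v u] at h2
  rw [S.christoffel_symm x w u, S.christoffel_symm x w v] at h3
  have e1 := (S.isHermitian x).g_J_left (S.christoffel x u w) v
  have e2 := (S.isHermitian x).symm (S.jLin x v) (S.christoffel x u w)
  refine (congr (congrArg _ (congr (congrArg _ h1) h2)) h3).trans ?_
  linarith

/-- The Nijenhuis tensor may be computed with any torsion-free connection, here with the flat one of
the chart and with Levi-Civita. -/
theorem nijenhuisOf_partialJ (x : M) (u v : TangentSpace (𝓡 n) x) :
    nijenhuisOf (S.jLin x) (S.partialJ x) u v = nijenhuisOf (S.jLin x) (S.nablaJAt x) u v := by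
  have h1 := S.christoffel_symm x u v
  have h2 := S.christoffel_symm x (S.jLin x u) v
  have h3 := S.christoffel_symm x u (S.jLin x v)
  have h4 := S.christoffel_symm x (S.jLin x u) (S.jLin x v)
  simp only [nijenhuisOf, partialJ_eq, map_sub, map_add]
  rw [h1, h2, h3, h4]
  abel

/-- `∇J` is a tensor. -/
theorem nablaJ_apply {X Y : Π x : M, TangentSpace (𝓡 n) x} (hY : IsSmoothVectorField Y) (x : M) :
    S.nablaJ X Y x = S.nablaJAt x (X x) (Y x) := by
  -- Metric compatibility applied to both sides of `g(JZ, W) = -g(Z, JW)`, with `W` a coordinate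
  -- field, eliminates the derivatives of `Z`; the right-hand side depends on `Z x` alone.
  have key : ∀ {Z : Π x : M, TangentSpace (𝓡 n) x}, MDifferentiableAt (𝓡 n) (𝓡 n).tangent
      (fun y ↦ (⟨y, Z y⟩ : TangentBundle (𝓡 n) M)) x → ∀ u w : TangentSpace (𝓡 n) x,
      S.gLin x (leviCivita S.g (fun y ↦ S.J y (Z y)) x u - S.jLin x (leviCivita S.g Z x u)) w =
        - S.gLin x (S.jLin x (Z x)) (S.christoffel x u w)
        - S.gLin x (Z x) (leviCivita S.g (fun y ↦ S.J y (coordField x w y)) x u) := by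
    intro Z hZ u w
    have hw := mdifferentiableAt_coordField x w
    have h1 := S.leviCivita_metric (S.mdifferentiableAt_J hZ) hw u
    have h2 := S.leviCivita_metric hZ (S.mdifferentiableAt_J hw) u
    have h3 : (fun y ↦ S.g.inner y (S.J y (Z y)) (coordField x w y)) =
        fun y ↦ - S.g.inner y (Z y) (S.J y (coordField x w y)) :=
      funext fun y ↦ (S.isHermitian y).g_J_left (Z y) (coordField x w y)
    have h4 : mvfderiv (𝓡 n) (fun y ↦ S.g.inner y (S.J y (Z y)) (coordField x w y)) x u =
        - mvfderiv (𝓡 n) (fun y ↦ S.g.inner y (Z y) (S.J y (coordField x w y))) x u := by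
      rw [h3, mvfderiv_fun_neg]
      rfl
    rw [coordField_apply_self] at h1 h2
    have h5 := (S.isHermitian x).g_J_left (leviCivita S.g Z x u) w
    rw [map_sub, LinearMap.sub_apply]
    have h6 : S.gLin x (S.J x (Z x)) (leviCivita S.g (coordField x w) x u) =
      S.gLin x (S.jLin x (Z x)) (S.christoffel x u w) := rfl
    have h7 : S.gLin x (leviCivita S.g Z x u) (S.J x w) =
      S.gLin x (leviCivita S.g Z x u) (S.jLin x w) := rfl
    linarith
  refine (S.isHermitian x).eq_of_inner_eq fun w ↦ ?_
  have h1 := key (hY.mdifferentiableAt (by simp)) (X x) w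
  have h2 := key (mdifferentiableAt_coordField x (Y x)) (X x) w
  rw [coordField_apply_self] at h2
  exact h1.trans h2.symm

end AlmostHermitian

end ExteriorDerivativeInCharts

/-! ### The integrability identity for `(3,0)`-forms -/

section TypeDecomposition

variable {E : Type*} [NormedAddCommGroup E] [NormedSpace ℝ E]

theorem ContinuousAlternatingMap.swap_left (f : E [⋀^Fin 3]→L[ℝ] ℝ) (u v w : E) :
    f ![u, v, w] = -f ![v, u, w] := by
  have h := f.toAlternatingMap.map_swap ![v, u, w] (show (0 : Fin 3) ≠ 1 by decide)
  refine Eq.trans (congrArg f (funext fun i ↦ ?_)) h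
  fin_cases i <;> rfl

theorem ContinuousAlternatingMap.swap_right (f : E [⋀^Fin 3]→L[ℝ] ℝ) (u v w : E) :
    f ![u, v, w] = -f ![u, w, v] := by
  have h := f.toAlternatingMap.map_swap ![u, w, v] (show (1 : Fin 3) ≠ 2 by decide)
  refine Eq.trans (congrArg f (funext fun i ↦ ?_)) h
  fin_cases i <;> rfl

theorem ContinuousAlternatingMap.add_left (f : E [⋀^Fin 3]→L[ℝ] ℝ) (u u' v w : E) :
    f ![u + u', v, w] = f ![u, v, w] + f ![u', v, w] := by
  simpa using f.map_vecCons_add (m := ![v, w]) u u'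

theorem ContinuousAlternatingMap.sub_left (f : E [⋀^Fin 3]→L[ℝ] ℝ) (u u' v w : E) :
    f ![u - u', v, w] = f ![u, v, w] - f ![u', v, w] := by
  have h := f.add_left (u - u') u' v w
  rw [sub_add_cancel] at h
  linarith

theorem fderiv_alternating_apply_left {A : E → E [⋀^Fin 3]→L[ℝ] ℝ} {j : E → E →L[ℝ] E} {p : E}
    (hA : DifferentiableAt ℝ A p) (hj : DifferentiableAt ℝ j p) (X a b c : E) :
    fderiv ℝ (fun z ↦ A z ![j z a, b, c]) p X = fderiv ℝ (fun z ↦ A z ![j p a, b, c]) p X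
      + A p ![fderiv ℝ (fun z ↦ j z a) p X, b, c] := by
  have h1 : ∀ i : Fin 3, HasFDerivAt (fun z ↦ ![j z a, b, c] i)
      ((![fderiv ℝ (fun z ↦ j z a) p, 0, 0] : Fin 3 → E →L[ℝ] E) i) p := by
    intro i
    fin_cases i
    · exact (hj.clm_apply (differentiableAt_const a)).hasFDerivAt
    · exact hasFDerivAt_const _ _
    · exact hasFDerivAt_const _ _
  have h := hA.hasFDerivAt.continuousAlternatingMap_apply h1
  have h' := hA.hasFDerivAt.continuousAlternatingMap_apply_const ![j p a, b, c]
  rw [h.fderiv, h'.fderiv, Fin.sum_univ_three]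
  have h2 : Function.update ![j p a, b, c] 0 (fderiv ℝ (fun z ↦ j z a) p X) =
      ![fderiv ℝ (fun z ↦ j z a) p X, b, c] := by
    ext i; fin_cases i <;> rfl
  simp only [add_apply, ContinuousLinearMap.coe_comp, Function.comp_apply]
  simp
  exact congrArg (A p) h2

/-- The integrability identity for forms of type `(3, 0)`: the part of `d(B - iA)` of type `(2, 2)`
is given by the Nijenhuis tensor. -/
theorem extDeriv_sub_extDeriv_of_type30 {A B : E → E [⋀^Fin 3]→L[ℝ] ℝ} {j : E → E →L[ℝ] E} {p : E}
    {j₀ : E →L[ℝ] E} (hA : DifferentiableAt ℝ A p) (hB : DifferentiableAt ℝ B p)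
    (hj : DifferentiableAt ℝ j p) (hj₀ : j p = j₀)
    (hBA : ∀ᶠ z in nhds p, ∀ a b c, B z ![j z a, b, c] = A z ![a, b, c])
    (hAB : ∀ᶠ z in nhds p, ∀ a b c, A z ![j z a, b, c] = -B z ![a, b, c]) (u v w z : E) :
    extDeriv B p ![u, v, w, z] - extDeriv B p ![j₀ u, j₀ v, w, z]
      + extDeriv A p ![j₀ u, v, w, z] + extDeriv A p ![u, j₀ v, w, z] =
      B p ![nijenhuisOf (j₀ : E →ₗ[ℝ] E) (fun X a ↦ fderiv ℝ (fun z ↦ j z a) p X) u v, w, z] := by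
  subst hj₀
  set P : E → E → E := fun X a ↦ fderiv ℝ (fun z ↦ j z a) p X with hP
  -- `r1` and `r2` are the derivatives of the two type relations along `X`; the terms with `P` come
  -- from differentiating `j`.
  have r1 : ∀ X a b c, fderiv ℝ (fun z ↦ B z ![j p a, b, c]) p X + B p ![P X a, b, c] =
      fderiv ℝ (fun z ↦ A z ![a, b, c]) p X := by
    intro X a b c
    rw [← fderiv_alternating_apply_left hB hj]
    exact congrArg (fun L : E →L[ℝ] ℝ ↦ L X) (Filter.EventuallyEq.fderiv_eq
      (hBA.mono fun z hz ↦ hz a b c))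
  have r2 : ∀ X a b c, fderiv ℝ (fun z ↦ A z ![j p a, b, c]) p X + A p ![P X a, b, c] =
      -fderiv ℝ (fun z ↦ B z ![a, b, c]) p X := by
    intro X a b c
    rw [← fderiv_alternating_apply_left hA hj, ← neg_apply, ← fderiv_fun_neg]
    exact congrArg (fun L : E →L[ℝ] ℝ ↦ L X) (Filter.EventuallyEq.fderiv_eq
      (hAB.mono fun z hz ↦ hz a b c))
  have s : ∀ (C : E → E [⋀^Fin 3]→L[ℝ] ℝ) X a b c, fderiv ℝ (fun z ↦ C z ![a, b, c]) p X =
      -fderiv ℝ (fun z ↦ C z ![b, a, c]) p X := by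
    intro C X a b c
    rw [← neg_apply, ← fderiv_fun_neg]
    simp only [← ContinuousAlternatingMap.swap_left]
  have hBA' := hBA.self_of_nhds
  rw [extDeriv_apply_three hA, extDeriv_apply_three hA, extDeriv_apply_three hB,
    extDeriv_apply_three hB, nijenhuisOf, ContinuousAlternatingMap.add_left,
    ContinuousAlternatingMap.sub_left]
  have e1 := hBA' (P v u - P u v) w z
  rw [ContinuousAlternatingMap.sub_left] at e1
  -- The left-hand side of the claim is the real part of `d(B - iA)` on `u + iJu, v + iJv, w, z`.
  -- With `e2` and `e3` the derivatives along `w` and `z` cancel; those along `u`, `v`, `Ju`, `Jv`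
  -- leave exactly the terms of the Nijenhuis tensor.
  have e2 : ∀ X c, fderiv ℝ (fun z ↦ B z ![j p u, j p v, c]) p X
      = -fderiv ℝ (fun z ↦ B z ![u, v, c]) p X - A p ![P X u, v, c] + A p ![P X v, u, c] := by
    intro X c
    have k1 := r1 X u (j p v) c
    have k2 := s A X u (j p v) c
    have k3 := r2 X v u c
    have k4 := s B X u v c
    have k5 := (B p).swap_left (P X u) (j p v) c
    have k6 := hBA' v (P X u) c
    have k7 := (A p).swap_left v (P X u) c
    linarith
  have e3 : ∀ X c, fderiv ℝ (fun z ↦ A z ![u, j p v, c]) p X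
      = -fderiv ℝ (fun z ↦ B z ![u, v, c]) p X + A p ![P X v, u, c] := by
    intro X c
    have k2 := s A X u (j p v) c
    have k3 := r2 X v u c
    have k4 := s B X u v c
    linarith
  have a1 := e2 w z
  have a2 := e2 z w
  have a3 := e3 w z
  have a4 := e3 z w
  have a5 := r2 w u v z
  have a6 := r2 z u v w
  have b1 := r2 u v w z
  have b2 := r2 v u w z
  have b3 := r1 (j p u) v w z
  have b4 := r1 (j p v) u w z
  simp only [ContinuousLinearMap.coe_coe]
  linarith

end TypeDecomposition

/-! ### The integrability identity on the manifold -/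

section TypeDecompositionOfForms

variable {n : ℕ} {M : Type*} [TopologicalSpace M] [ChartedSpace (EuclideanSpace ℝ (Fin n)) M]
  [IsManifold (𝓡 n) ∞ M]

namespace AlmostHermitian

variable (S : AlmostHermitian n M)

/-- The real and imaginary parts of a form of type `(3, 0)`. -/
structure IsTypePair (A B : DForm n M 3 ℝ) : Prop where
  im_J : ∀ (x : M) (u v w : TangentSpace (𝓡 n) x), B x ![S.J x u, v, w] = A x ![u, v, w]
  re_J : ∀ (x : M) (u v w : TangentSpace (𝓡 n) x), A x ![S.J x u, v, w] = -B x ![u, v, w]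

variable {S} {A B : DForm n M 3 ℝ}

theorem inChart_J (C D : DForm n M 3 ℝ)
    (h : ∀ (x : M) (u v w : TangentSpace (𝓡 n) x), C x ![S.J x u, v, w] = D x ![u, v, w])
    {x : M} {p : EuclideanSpace ℝ (Fin n)} (hp : p ∈ (extChartAt (𝓡 n) x).target)
    (a b c : EuclideanSpace ℝ (Fin n)) :
    C.inChart x p ![S.jInChart x p a, b, c] = D.inChart x p ![a, b, c] := by
  rw [DForm.inChart_apply _ hp, DForm.inChart_apply _ hp]
  set y := (extChartAt (𝓡 n) x).symm p
  have h1 := h y (coordField x a y) (coordField x b y) (coordField x c y)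
  rw [← S.coordField_jInChart hp a] at h1
  refine Eq.trans (congrArg (C y) (funext fun i ↦ ?_)) (h1.trans
    (congrArg (D y) (funext fun i ↦ ?_)))
  all_goals fin_cases i <;> rfl

theorem IsTypePair.d_sub_d (h : S.IsTypePair A B) (hA : A.IsSmooth) (hB : B.IsSmooth)
    (hd : A.d = 0) (x : M) (u v w z : TangentSpace (𝓡 n) x) :
    B.d x ![u, v, w, z] - B.d x ![S.jLin x u, S.jLin x v, w, z] =
      -A x ![S.jLin x (nijenhuisOf (S.jLin x) (S.nablaJAt x) u v), w, z] := by
  have hmem := (isOpen_extChartAt_target (I := 𝓡 n) x).mem_nhds (mem_extChartAt_target x)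
  have key := extDeriv_sub_extDeriv_of_type30 (hA.differentiableAt x) (hB.differentiableAt x)
    (S.differentiableAt_jInChart x) (j₀ := S.J x)
    (ContinuousLinearMap.ext fun v ↦ S.jInChart_self x v)
    (by filter_upwards [hmem] with p hp using inChart_J B A h.im_J hp)
    (by filter_upwards [hmem] with p hp using
      inChart_J A (fun y ↦ -B y) (fun y a b c ↦ h.re_J y a b c) hp) u v w z
  have d1 := A.d_apply x ![S.J x u, v, w, z]
  have d2 := A.d_apply x ![u, S.J x v, w, z]
  have d3 := B.d_apply x ![u, v, w, z]
  have d4 := B.d_apply x ![S.J x u, S.J x v, w, z]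
  have key' : B.d x ![u, v, w, z] - B.d x ![S.jLin x u, S.jLin x v, w, z]
      + A.d x ![S.jLin x u, v, w, z] + A.d x ![u, S.jLin x v, w, z] =
      B x ![nijenhuisOf (S.jLin x) (S.partialJ x) u v, w, z] :=
    (congr (congrArg _ (congr (congrArg _ (congr (congrArg _ d3) d4)) d1)) d2).trans
      (key.trans (B.inChart_self_apply x _))
  have h1 : A x ![S.jLin x (nijenhuisOf (S.jLin x) (S.nablaJAt x) u v), w, z] =
    -B x ![nijenhuisOf (S.jLin x) (S.nablaJAt x) u v, w, z] := h.re_J x _ w z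
  have h2 : ∀ v, A.d x v = 0 := fun v ↦ by rw [hd]; rfl
  rw [h2, h2, nijenhuisOf_partialJ] at key'
  linarith

end AlmostHermitian

end TypeDecompositionOfForms

/-! ### From the structure equations to nearly Kähler and `SU(3)` -/

section StructureEquations

/-- Every tangent vector is the value of a smooth vector field. -/
theorem exists_isSmoothVectorField {n : ℕ} {M : Type*} [TopologicalSpace M] [T2Space M]
    [ChartedSpace (EuclideanSpace ℝ (Fin n)) M] [IsManifold (𝓡 n) ∞ M] (x : M)
    (v : TangentSpace (𝓡 n) x) :
    ∃ X : Π x : M, TangentSpace (𝓡 n) x, IsSmoothVectorField X ∧ X x = v := by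
  obtain ⟨f⟩ : Nonempty (SmoothBumpFunction (𝓡 n) x) := inferInstance
  refine ⟨(f : M → ℝ) • fun y ↦ (coordField x v y : TangentSpace (𝓡 n) y), ?_, ?_⟩
  · exact ContMDiffOn.smul_section_of_tsupport (u := (extChartAt (𝓡 n) x).source)
      f.contMDiff.contMDiffOn (isOpen_extChartAt_source x) f.tsupport_subset_extChartAt_source
      (contMDiffOn_coordField x v)
  · have h : f x • (coordField x v x : TangentSpace (𝓡 n) x) = v := by
      rw [coordField_apply_self, f.eq_one, one_smul]
    exact h

variable {n : ℕ} {M : Type*} [TopologicalSpace M] [ChartedSpace (EuclideanSpace ℝ (Fin n)) M]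

namespace DForm

theorem d_smul {k : ℕ} (c : ℝ) (α : DForm n M k ℝ) [IsManifold (𝓡 n) ∞ M] :
    (c • α).d = c • α.d := by
  funext x
  ext v
  refine (d_apply _ x v).trans ?_
  have h : (c • α).inChart x = c • α.inChart x := rfl
  rw [h, extDeriv_smul]
  exact congrArg (c * ·) (d_apply α x v).symm

theorem IsSmooth.smul {k : ℕ} {α : DForm n M k ℝ} (hα : α.IsSmooth) (c : ℝ) :
    (c • α).IsSmooth := fun x ↦
  (contDiffOn_const (c := c)).smul (hα x)

theorem IsSmooth.contDiffOn_apply {k : ℕ} {F : Type*} [NormedAddCommGroup F] [NormedSpace ℝ F]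
    {α : DForm n M k F} (hα : α.IsSmooth) (x : M) (v : Fin k → EuclideanSpace ℝ (Fin n)) :
    ContDiffOn ℝ ∞ (fun u ↦ α.inChart x u v) (extChartAt (𝓡 n) x).target :=
  (ContinuousAlternatingMap.apply ℝ (EuclideanSpace ℝ (Fin n)) F v).contDiff.comp_contDiffOn (hα x)

theorem IsSmooth.re {k : ℕ} {ψ : DForm n M k ℂ} (hψ : ψ.IsSmooth) : ψ.re.IsSmooth := fun x ↦
  contDiffOn_continuousAlternatingMap_of_apply fun v ↦
    Complex.reCLM.contDiff.comp_contDiffOn (hψ.contDiffOn_apply x v)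

theorem IsSmooth.im {k : ℕ} {ψ : DForm n M k ℂ} (hψ : ψ.IsSmooth) : ψ.im.IsSmooth := fun x ↦
  contDiffOn_continuousAlternatingMap_of_apply fun v ↦
    Complex.imCLM.contDiff.comp_contDiffOn (hψ.contDiffOn_apply x v)

/-- The value of a three-form at a point as a trilinear map. -/
noncomputable def trilinearAt (α : DForm n M 3 ℝ) (x : M) : TangentSpace (𝓡 n) x →ₗ[ℝ]
    TangentSpace (𝓡 n) x →ₗ[ℝ] TangentSpace (𝓡 n) x →ₗ[ℝ] ℝ :=
  (α x).toAlternatingMap.toTrilinear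

theorem trilinearAt_apply (α : DForm n M 3 ℝ) (x : M) (u v w : TangentSpace (𝓡 n) x) :
    α.trilinearAt x u v w = α x ![u, v, w] := rfl

theorem three_swap_left (α : DForm n M 3 ℝ) (x : M) (u v w : TangentSpace (𝓡 n) x) :
    α x ![u, v, w] = -α x ![v, u, w] :=
  ContinuousAlternatingMap.swap_left (E := EuclideanSpace ℝ (Fin n)) (α x) u v w

theorem three_swap_right (α : DForm n M 3 ℝ) (x : M) (u v w : TangentSpace (𝓡 n) x) :
    α x ![u, v, w] = -α x ![u, w, v] :=
  ContinuousAlternatingMap.swap_right (E := EuclideanSpace ℝ (Fin n)) (α x) u v w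

end DForm

namespace AlmostHermitian

variable [IsManifold (𝓡 n) ∞ M] {S : AlmostHermitian n M}

theorem IsType30.isTypePair {ψ : DForm n M 3 ℂ} (h : S.IsType30 ψ) :
    S.IsTypePair ψ.re ψ.im := by
  have re : ∀ (x : M) (v : Fin 3 → TangentSpace (𝓡 n) x), ψ.re x v = (ψ x v).re := fun _ _ ↦ rfl
  have im : ∀ (x : M) (v : Fin 3 → TangentSpace (𝓡 n) x), ψ.im x v = (ψ x v).im := fun _ _ ↦ rfl
  constructor <;> intro x u v w
  · have h1 := congrArg Complex.re (h x u v w)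
    simp at h1
    rw [re, im]
    linarith
  · have h1 := congrArg Complex.im (h x u v w)
    simp at h1
    rw [re, im]
    linarith

theorem IsTypePair.isRealType30 {A B : DForm n M 3 ℝ} (h : S.IsTypePair A B) (x : M) :
    IsRealType30 (S.jLin x) (A.trilinearAt x) where
  swap₁ := A.three_swap_left x
  swap₂ := A.three_swap_right x
  J_left u v w := by
    simp only [DForm.trilinearAt_apply]
    have h1 : A x ![S.jLin x u, v, w] = -B x ![u, v, w] := h.re_J x u v w
    have h2 : A x ![S.jLin x v, u, w] = -B x ![v, u, w] := h.re_J x v u w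
    have h3 := A.three_swap_left x u (S.jLin x v) w
    have h4 := B.three_swap_left x u v w
    linarith

theorem finrank_tangentSpace {M : Type*} [TopologicalSpace M]
    [ChartedSpace (EuclideanSpace ℝ (Fin 6)) M] (x : M) :
    Module.finrank ℝ (TangentSpace (𝓡 6) x) = 6 :=
  finrank_euclideanSpace_fin

section Six

variable {M : Type*} [TopologicalSpace M] [ChartedSpace (EuclideanSpace ℝ (Fin 6)) M]
  [IsManifold (𝓡 6) ∞ M] {S : AlmostHermitian 6 M}

variable (S) in
theorem exists_unitaryFrame (x : M) : ∃ e, IsUnitaryFrame (S.gLin x) (S.jLin x) e := by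
  have : FiniteDimensional ℝ (TangentSpace (𝓡 6) x) :=
    Module.finite_of_finrank_pos (by rw [finrank_tangentSpace]; norm_num)
  obtain ⟨u, hu, -⟩ := (S.isHermitian x).exists_unit_normal (m := 0) ![]
    (by rw [finrank_tangentSpace]; norm_num)
  obtain ⟨e, he, -⟩ := (S.isHermitian x).exists_isUnitaryFrame (finrank_tangentSpace x) hu
  exact ⟨e, he⟩

/-- The structure equations determine `∇ J` and the norm of the three-form. -/
theorem IsTypePair.of_structure_equations {A B : DForm 6 M 3 ℝ} (h : S.IsTypePair A B)
    (hA : A.IsSmooth) (hB : B.IsSmooth) {μ : ℝ} (hμ : μ ≠ 0) (hσ : S.σ.d = (3 * μ) • A)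
    (hd : B.d = (-2 * μ) • S.σ.wedge S.σ) (x : M) :
    (∀ u v w, S.gLin x (S.nablaJAt x u v) w = μ * A x ![u, v, w]) ∧
      ∃ f, IsUnitaryFrame (S.gLin x) (S.jLin x) f ∧ A x ![f 0, f 1, f 2] = 1 ∧
        B x ![f 0, f 1, f 2] = 0 := by
  obtain ⟨e, he⟩ := S.exists_unitaryFrame x
  -- Up to the nonzero factor `3μ`, the form `A` is exact.
  have hdA : A.d = 0 := by
    have h1 := S.isSmooth_σ.d_d
    rw [hσ, DForm.d_smul] at h1
    exact (smul_eq_zero.1 h1).resolve_left (by simpa using hμ)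
  have key := (h.isRealType30 x).inner_eq_of_structure_equations (S.isHermitian x)
    (finrank_tangentSpace x) he hμ (T := S.nablaJAt x) (S.nablaJAt_skew x) (S.nablaJAt_J x)
    (fun u v w ↦ by
      rw [← d_σ_apply, hσ]
      rfl)
    -- In the difference of the values of `σ ∧ σ` at `(u, v)` and `(Ju, Jv)` the term `σ(u, v) σ(w,
    -- z)` cancels, and `σ(Ju, w) = -g(u, w)` produces the metric terms.
    (fun u v w z ↦ by
      have h1 := h.d_sub_d hA hB hdA x u v w z
      have h2 : ∀ u v w z, B.d x ![u, v, w, z] = -2 * μ * (S.σ.wedge S.σ) x ![u, v, w, z] :=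
        fun u v w z ↦ by rw [hd]; rfl
      rw [h2, h2, DForm.wedge_self_apply, DForm.wedge_self_apply] at h1
      simp only [σ_apply, (S.isHermitian x).J_J, map_neg,
        LinearMap.neg_apply] at h1
      rw [DForm.trilinearAt_apply]
      rw [(S.isHermitian x).g_J_left u v] at h1
      linarith)
  refine ⟨key.2, ?_⟩
  obtain ⟨f, hf, h1, h2⟩ := (S.isHermitian x).exists_frame_eq_one he (A.trilinearAt x) key.1
  refine ⟨f, hf, h1, ?_⟩
  have h3 : A x ![S.jLin x (f 0), f 1, f 2] = -B x ![f 0, f 1, f 2] := h.re_J x _ _ _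
  rw [DForm.trilinearAt_apply] at h2
  linarith

theorem isSU3Structure_of_structure_equations {ψ : DForm 6 M 3 ℂ} (hψ : ψ.IsSmooth)
    (h : S.IsType30 ψ) {μ : ℝ} (hμ : μ ≠ 0) (hσ : S.σ.d = (3 * μ) • ψ.re)
    (hd : ψ.im.d = (-2 * μ) • S.σ.wedge S.σ) : S.IsSU3Structure ψ := by
  refine ⟨h, fun x ↦ ?_⟩
  obtain ⟨-, f, hf, h1, h2⟩ := h.isTypePair.of_structure_equations hψ.re hψ.im hμ hσ hd x
  refine ⟨f, hf.inner_eq, hf.inner_J_eq, ?_⟩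
  have hv : ![f 0, f 1, f 2] = f := by ext i; fin_cases i <;> rfl
  rw [hv] at h1 h2
  exact Complex.ext h1 h2

theorem isNearlyKahler_of_structure_equations [T2Space M] [Nonempty M] {ψ : DForm 6 M 3 ℂ}
    (hψ : ψ.IsSmooth) (h : S.IsType30 ψ) {μ : ℝ} (hμ : μ ≠ 0) (hσ : S.σ.d = (3 * μ) • ψ.re)
    (hd : ψ.im.d = (-2 * μ) • S.σ.wedge S.σ) : S.IsNearlyKahler := by
  have key := h.isTypePair.of_structure_equations hψ.re hψ.im hμ hσ hd
  constructor
  · intro X hX x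
    rw [S.nablaJ_apply hX]
    refine (S.isHermitian x).eq_of_inner_eq fun w ↦ ?_
    have h1 := ψ.re.three_swap_left x (X x) (X x) w
    rw [(key x).1, map_zero, LinearMap.zero_apply]
    have h2 : ψ.re x ![X x, X x, w] = 0 := by linarith
    rw [h2, mul_zero]
  · obtain ⟨x⟩ := ‹Nonempty M›
    obtain ⟨h1, f, -, h2, -⟩ := key x
    obtain ⟨X, hX, hX'⟩ := exists_isSmoothVectorField x (f 0)
    obtain ⟨Y, hY, hY'⟩ := exists_isSmoothVectorField x (f 1)
    refine ⟨X, Y, hX, hY, x, fun h0 ↦ hμ ?_⟩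
    rw [S.nablaJ_apply hY, hX', hY'] at h0
    have h3 := h1 (f 0) (f 1) (f 2)
    rw [h0, map_zero, LinearMap.zero_apply, h2, mul_one] at h3
    exact h3.symm

end Six

end AlmostHermitian

end StructureEquations

/-! ### Four-forms proportional to the square of a two-form -/

section FourForms

variable {E : Type*} [NormedAddCommGroup E] [NormedSpace ℝ E]

theorem ContinuousAlternatingMap.four_swap_left (f : E [⋀^Fin 4]→L[ℝ] ℝ) (u v w z : E) :
    f ![u, v, w, z] = -f ![v, u, w, z] := by
  have h := f.toAlternatingMap.map_swap ![v, u, w, z] (show (0 : Fin 4) ≠ 1 by decide)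
  refine Eq.trans (congrArg f (funext fun i ↦ ?_)) h
  fin_cases i <;> rfl

theorem ContinuousAlternatingMap.four_swap_mid (f : E [⋀^Fin 4]→L[ℝ] ℝ) (u v w z : E) :
    f ![u, v, w, z] = -f ![u, w, v, z] := by
  have h := f.toAlternatingMap.map_swap ![u, w, v, z] (show (1 : Fin 4) ≠ 2 by decide)
  refine Eq.trans (congrArg f (funext fun i ↦ ?_)) h
  fin_cases i <;> rfl

theorem ContinuousAlternatingMap.four_neg_left (f : E [⋀^Fin 4]→L[ℝ] ℝ) (u v w z : E) :
    f ![-u, v, w, z] = -f ![u, v, w, z] := by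
  simpa using f.map_vecCons_smul (m := ![v, w, z]) (-1 : ℝ) u

theorem extDeriv_apply_four {α : E → E [⋀^Fin 4]→L[ℝ] ℝ} {p : E} (hα : DifferentiableAt ℝ α p)
    (x u v w z : E) : extDeriv α p ![x, u, v, w, z] =
      fderiv ℝ (fun y ↦ α y ![u, v, w, z]) p x - fderiv ℝ (fun y ↦ α y ![x, v, w, z]) p u
      + fderiv ℝ (fun y ↦ α y ![x, u, w, z]) p v - fderiv ℝ (fun y ↦ α y ![x, u, v, z]) p w
      + fderiv ℝ (fun y ↦ α y ![x, u, v, w]) p z := by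
  rw [extDeriv_apply hα, Fin.sum_univ_five]
  have h0 : Fin.removeNth 0 ![x, u, v, w, z] = ![u, v, w, z] := by ext i; fin_cases i <;> rfl
  have h1 : Fin.removeNth 1 ![x, u, v, w, z] = ![x, v, w, z] := by ext i; fin_cases i <;> rfl
  have h2 : Fin.removeNth 2 ![x, u, v, w, z] = ![x, u, w, z] := by ext i; fin_cases i <;> rfl
  have h3 : Fin.removeNth 3 ![x, u, v, w, z] = ![x, u, v, z] := by ext i; fin_cases i <;> rfl
  have h4 : Fin.removeNth 4 ![x, u, v, w, z] = ![x, u, v, w] := by ext i; fin_cases i <;> rfl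
  rw [h0, h1, h2, h3, h4]
  simp
  ring

/-- The derivative of a multiple of the square of a two-form. -/
theorem fderiv_mul_wedge_self {s : E → E [⋀^Fin 2]→L[ℝ] ℝ} {r : E → ℝ} {p : E}
    (hs : DifferentiableAt ℝ s p) (hr : DifferentiableAt ℝ r p) {f : E → ℝ} {a b c d : E}
    (hf : ∀ᶠ z in nhds p, f z = -4 * r z * (s z ![a, b] * s z ![c, d] - s z ![a, c] * s z ![b, d]
      + s z ![a, d] * s z ![b, c])) (X : E) :
    fderiv ℝ f p X = -4 * (fderiv ℝ r p X * (s p ![a, b] * s p ![c, d]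
        - s p ![a, c] * s p ![b, d] + s p ![a, d] * s p ![b, c])
      + r p * (fderiv ℝ (fun z ↦ s z ![a, b]) p X * s p ![c, d]
        + s p ![a, b] * fderiv ℝ (fun z ↦ s z ![c, d]) p X
        - fderiv ℝ (fun z ↦ s z ![a, c]) p X * s p ![b, d]
        - s p ![a, c] * fderiv ℝ (fun z ↦ s z ![b, d]) p X
        + fderiv ℝ (fun z ↦ s z ![a, d]) p X * s p ![b, c]
        + s p ![a, d] * fderiv ℝ (fun z ↦ s z ![b, c]) p X)) := by
  have h : ∀ v, HasFDerivAt (fun z ↦ s z v) (fderiv ℝ (fun z ↦ s z v) p) p := fun v ↦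
    (hs.hasFDerivAt.continuousAlternatingMap_apply_const v).differentiableAt.hasFDerivAt
  have h1 := (hr.hasFDerivAt.const_mul (-4)).mul ((((h ![a, b]).mul (h ![c, d])).sub
    ((h ![a, c]).mul (h ![b, d]))).add ((h ![a, d]).mul (h ![b, c])))
  rw [(h1.congr_of_eventuallyEq hf).fderiv]
  simp only [add_apply, smul_apply, sub_apply, smul_eq_mul, Pi.add_apply, Pi.sub_apply, Pi.mul_apply]
  ring

/-- Here `β = -2 r s ∧ s`, so `dβ = -2 dr ∧ s ∧ s - 4 r ds ∧ s`. When `(a, b)` and `(c, d)` are dual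
pairs for `s`, orthogonal to each other and to `X`, each term reduces to what is displayed. -/
theorem extDeriv_mul_wedge_self {s : E → E [⋀^Fin 2]→L[ℝ] ℝ} {β : E → E [⋀^Fin 4]→L[ℝ] ℝ}
    {r : E → ℝ} {p : E} (hs : DifferentiableAt ℝ s p) (hβ : DifferentiableAt ℝ β p)
    (hr : DifferentiableAt ℝ r p)
    (h : ∀ᶠ z in nhds p, ∀ a b c d, β z ![a, b, c, d] = -4 * r z * (s z ![a, b] * s z ![c, d]
      - s z ![a, c] * s z ![b, d] + s z ![a, d] * s z ![b, c])) {X a b c d : E}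
    (ha : s p ![X, a] = 0) (hb : s p ![X, b] = 0) (hc : s p ![X, c] = 0) (hd : s p ![X, d] = 0)
    (hab : s p ![a, b] = 1) (hcd : s p ![c, d] = 1) (hac : s p ![a, c] = 0)
    (hbd : s p ![b, d] = 0) (had : s p ![a, d] = 0) (hbc : s p ![b, c] = 0) :
    extDeriv β p ![X, a, b, c, d] = -4 * (fderiv ℝ r p X
      + r p * (extDeriv s p ![X, a, b] + extDeriv s p ![X, c, d])) := by
  have k := fun a b c d ↦ fderiv_mul_wedge_self hs hr (h.mono fun z hz ↦ hz a b c d)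
  rw [extDeriv_apply_four hβ, extDeriv_apply_two hs, extDeriv_apply_two hs, k, k, k, k, k]
  rw [ha, hb, hc, hd, hab, hcd, hac, hbd, had, hbc]
  ring

/-- No regularity of `r` is assumed: it is recovered as the quotient of a component of `β` by a
nonvanishing component of the square of `s`. -/
theorem differentiableAt_of_eq_mul_wedge_self {s : E → E [⋀^Fin 2]→L[ℝ] ℝ}
    {β : E → E [⋀^Fin 4]→L[ℝ] ℝ} {r : E → ℝ} {p : E} (hs : DifferentiableAt ℝ s p)
    (hβ : DifferentiableAt ℝ β p) {a b c d : E}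
    (h : ∀ᶠ z in nhds p, β z ![a, b, c, d] = -4 * r z * (s z ![a, b] * s z ![c, d]
      - s z ![a, c] * s z ![b, d] + s z ![a, d] * s z ![b, c]))
    (h0 : s p ![a, b] * s p ![c, d] - s p ![a, c] * s p ![b, d] + s p ![a, d] * s p ![b, c] ≠ 0) :
    DifferentiableAt ℝ r p := by
  have hs' : ∀ v, DifferentiableAt ℝ (fun z ↦ s z v) p := fun v ↦
    (hs.hasFDerivAt.continuousAlternatingMap_apply_const v).differentiableAt
  have hβ' : DifferentiableAt ℝ (fun z ↦ β z ![a, b, c, d]) p :=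
    (hβ.hasFDerivAt.continuousAlternatingMap_apply_const _).differentiableAt
  have hq : DifferentiableAt ℝ (fun z ↦ s z ![a, b] * s z ![c, d] - s z ![a, c] * s z ![b, d]
      + s z ![a, d] * s z ![b, c]) p :=
    (((hs' _).mul (hs' _)).sub ((hs' _).mul (hs' _))).add ((hs' _).mul (hs' _))
  have h0' : (-4 : ℝ) * (s p ![a, b] * s p ![c, d] - s p ![a, c] * s p ![b, d]
      + s p ![a, d] * s p ![b, c]) ≠ 0 := mul_ne_zero (by norm_num) h0
  have hd := hβ'.fun_mul ((hq.const_mul (-4 : ℝ)).fun_inv h0')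
  refine hd.congr_of_eventuallyEq ?_
  filter_upwards [h, hq.continuousAt.eventually_ne h0] with z hz hz0
  rw [hz]
  field_simp

theorem contDiffOn_alternating_apply_left {D : Type*} [NormedAddCommGroup D] [NormedSpace ℝ D]
    [FiniteDimensional ℝ E] {A : D → E [⋀^Fin 3]→L[ℝ] ℝ} {Y : D → E} {t : Set D}
    (hA : ContDiffOn ℝ ∞ A t) (hY : ContDiffOn ℝ ∞ Y t) (b c : E) :
    ContDiffOn ℝ ∞ (fun z ↦ A z ![Y z, b, c]) t := by
  have h : ∀ (f : E [⋀^Fin 3]→L[ℝ] ℝ) a, f.toContinuousLinearMap ![0, b, c] 0 a = f ![a, b, c] := by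
    intro f a
    refine congrArg f (funext fun i ↦ ?_)
    fin_cases i <;> rfl
  have h1 : ContDiffOn ℝ ∞ (fun z ↦ (A z).toContinuousLinearMap ![0, b, c] 0) t := by
    rw [contDiffOn_clm_apply]
    intro a
    simp only [h]
    exact (ContinuousAlternatingMap.apply ℝ E ℝ ![a, b, c]).contDiff.comp_contDiffOn hA
  exact (h1.clm_apply hY).congr fun z _ ↦ (h _ _).symm

end FourForms

/-! ### Functions with zero differential -/

section ConstantFunctions

variable {n : ℕ} {M : Type*} [TopologicalSpace M] [ChartedSpace (EuclideanSpace ℝ (Fin n)) M]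

theorem hasMFDerivAt_of_hasFDerivAt_extChartAt {f : M → ℝ} {x : M}
    {f' : EuclideanSpace ℝ (Fin n) →L[ℝ] ℝ}
    (h : HasFDerivAt (fun z ↦ f ((extChartAt (𝓡 n) x).symm z)) f' (extChartAt (𝓡 n) x x)) :
    HasMFDerivAt (𝓡 n) 𝓘(ℝ, ℝ) f x f' := by
  refine ⟨?_, ?_⟩
  · have h1 := h.continuousAt.comp (continuousAt_extChartAt (I := 𝓡 n) x)
    refine h1.congr ?_
    filter_upwards [extChartAt_source_mem_nhds (I := 𝓡 n) x] with y hy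
    simp only [Function.comp_apply, (extChartAt (𝓡 n) x).left_inv hy]
  · exact h.hasFDerivWithinAt

/-- A function with vanishing differential on a connected manifold is constant. -/
theorem eq_of_hasMFDerivAt_zero [IsManifold (𝓡 n) ∞ M] [PreconnectedSpace M] {f : M → ℝ}
    (h : ∀ x, HasMFDerivAt (𝓡 n) 𝓘(ℝ, ℝ) f x 0) (x y : M) : f x = f y := by
  have hl : IsLocallyConstant f := by
    rw [IsLocallyConstant.iff_eventually_eq]
    intro x
    obtain ⟨ε, hε, hb⟩ := Metric.isOpen_iff.1 (isOpen_extChartAt_target (I := 𝓡 n) x) _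
      (mem_extChartAt_target x)
    have hd : ∀ z ∈ Metric.ball (extChartAt (𝓡 n) x x) ε,
        HasFDerivAt (fun z ↦ f ((extChartAt (𝓡 n) x).symm z))
          (0 : EuclideanSpace ℝ (Fin n) →L[ℝ] ℝ) z := by
      intro z hz
      have h1 := (h ((extChartAt (𝓡 n) x).symm z)).comp z
        (mdifferentiableAt_extChartAt_symm (hb hz)).hasMFDerivAt
      have h2 := h1.hasFDerivAt
      exact h2
    have hc : ∀ z ∈ Metric.ball (extChartAt (𝓡 n) x x) ε,
        f ((extChartAt (𝓡 n) x).symm z) = f ((extChartAt (𝓡 n) x).symm (extChartAt (𝓡 n) x x)) := by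
      intro z hz
      refine Metric.isOpen_ball.is_const_of_fderiv_eq_zero (𝕜 := ℝ)
        (convex_ball _ _).isPreconnected
        (fun w hw ↦ (hd w hw).differentiableAt.differentiableWithinAt)
        (fun w hw ↦ (hd w hw).fderiv) hz (Metric.mem_ball_self hε)
    have hn := (continuousAt_extChartAt (I := 𝓡 n) x).preimage_mem_nhds (Metric.ball_mem_nhds _ hε)
    filter_upwards [hn, extChartAt_source_mem_nhds (I := 𝓡 n) x] with y hy hy'
    have h3 := hc _ hy
    rwa [(extChartAt (𝓡 n) x).left_inv hy', extChartAt_to_inv] at h3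
  exact hl.apply_eq_of_isPreconnected isPreconnected_univ trivial trivial

end ConstantFunctions

/-! ### The three-form of a nearly Kähler manifold -/

section NearlyKahler

/-- Moving `J` to the first slot leaves a repeated vector. Applied to `dσ`, this removes the term
`dσ ∧ σ` from the derivative of `ρ σ ∧ σ`. -/
theorem IsRealType30.apply_J_self {V : Type*} [AddCommGroup V] [Module ℝ V] {J : V →ₗ[ℝ] V}
    {A : V →ₗ[ℝ] V →ₗ[ℝ] V →ₗ[ℝ] ℝ} (hA : IsRealType30 J A) (u v : V) : A u v (J v) = 0 := by
  have h1 := hA.swap₂ u v (J v)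
  have h2 := hA.J_left u v v
  have h3 := hA.swap₂ (J u) v v
  linarith

namespace AlmostHermitian

variable {n : ℕ} {M : Type*} [TopologicalSpace M] [ChartedSpace (EuclideanSpace ℝ (Fin n)) M]
  [IsManifold (𝓡 n) ∞ M] (S : AlmostHermitian n M)

theorem nablaJAt_add_left (x : M) (u u' v : TangentSpace (𝓡 n) x) :
    S.nablaJAt x (u + u') v = S.nablaJAt x u v + S.nablaJAt x u' v := by
  have h1 : S.christoffel x (u + u') v = S.christoffel x u v + S.christoffel x u' v := map_add _ _ _
  rw [nablaJAt, nablaJAt, nablaJAt, h1, map_add, map_add]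
  abel

theorem nablaJAt_add_right (x : M) (u v v' : TangentSpace (𝓡 n) x) :
    S.nablaJAt x u (v + v') = S.nablaJAt x u v + S.nablaJAt x u v' := by
  refine (S.isHermitian x).eq_of_inner_eq fun w ↦ ?_
  rw [nablaJAt_skew, map_add, map_add, LinearMap.add_apply, nablaJAt_skew S x u v,
    nablaJAt_skew S x u v']
  ring

/-- The form `A(J·, J·, J·)`. -/
noncomputable def conjForm (A : DForm n M 3 ℝ) : DForm n M 3 ℝ := fun x ↦
  (A x).compContinuousLinearMap (S.J x)

theorem conjForm_apply (A : DForm n M 3 ℝ) (x : M) (u v w : TangentSpace (𝓡 n) x) :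
    S.conjForm A x ![u, v, w] = A x ![S.J x u, S.J x v, S.J x w] := by
  refine congrArg (A x) (funext fun i ↦ ?_)
  fin_cases i <;> rfl

variable {S}

/-- By skewness `J` passes freely between all three slots; pairs of `J` then give `A(J·, J·, J·) =
-A(J·, ·, ·)`, the imaginary part required by complex linearity. -/
theorem isTypePair_conjForm {A : DForm n M 3 ℝ}
    (h : ∀ (x : M) (u v w : TangentSpace (𝓡 n) x), A x ![S.J x u, v, w] = A x ![u, S.J x v, w]) :
    S.IsTypePair A (S.conjForm A) := by
  have h2 : ∀ (x : M) (u v w : TangentSpace (𝓡 n) x),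
      A x ![u, S.J x v, w] = A x ![u, v, S.J x w] := by
    intro x u v w
    have e1 := A.three_swap_left x u (S.J x v) w
    have e2 := A.three_swap_right x (S.J x v) u w
    have e3 := h x v w u
    have e4 := A.three_swap_left x v (S.J x w) u
    have e5 := A.three_swap_right x (S.J x w) v u
    have e6 := A.three_swap_left x (S.J x w) u v
    have e7 := A.three_swap_right x u (S.J x w) v
    linarith
  have neg : ∀ (x : M) (u v w : TangentSpace (𝓡 n) x), A x ![-u, v, w] = -A x ![u, v, w] := by
    intro x u v w
    have := map_neg (A.trilinearAt x) u
    exact congrArg (fun L : TangentSpace (𝓡 n) x →ₗ[ℝ] TangentSpace (𝓡 n) x →ₗ[ℝ] ℝ ↦ L v w) this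
  constructor <;> intro x u v w
  · rw [conjForm_apply, h, S.J_J, ← h2, h, S.J_J, neg_neg]
  · rw [conjForm_apply, h2, ← h2 x _ v, ← h, S.J_J, neg, neg_neg]
    exact (h x u v w).trans (h2 x u v w)

/-- The relation `B = -A(J·, ·, ·)` expresses `B` through smooth data. -/
theorem IsTypePair.isSmooth {A B : DForm n M 3 ℝ} (h : S.IsTypePair A B) (hA : A.IsSmooth) :
    B.IsSmooth := by
  intro x
  refine contDiffOn_continuousAlternatingMap_of_apply fun v ↦ ?_
  have h1 := contDiffOn_alternating_apply_left (hA x)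
    ((S.contDiffOn_jInChart x).clm_apply (contDiffOn_const (c := v 0))) (v 1) (v 2)
  refine h1.neg.congr fun z hz ↦ ?_
  have h2 := inChart_J A (fun y ↦ -B y) (fun y a b c ↦ h.re_J y a b c) hz (v 0) (v 1) (v 2)
  have h3 : B.inChart x z v = -DForm.inChart (fun y ↦ -B y) x z ![v 0, v 1, v 2] := by
    refine (congrArg (B.inChart x z) (funext fun i ↦ ?_)).trans
      (neg_neg (B.inChart x z ![v 0, v 1, v 2])).symm
    fin_cases i <;> rfl
  rw [h3, ← h2]

namespace IsNearlyKahler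

variable [T2Space M]

theorem nablaJAt_self (h : S.IsNearlyKahler) (x : M) (u : TangentSpace (𝓡 n) x) :
    S.nablaJAt x u u = 0 := by
  obtain ⟨X, hX, rfl⟩ := exists_isSmoothVectorField x u
  rw [← S.nablaJ_apply hX]
  exact h.1 X hX x

theorem nablaJAt_swap (h : S.IsNearlyKahler) (x : M) (u v : TangentSpace (𝓡 n) x) :
    S.nablaJAt x u v = -S.nablaJAt x v u := by
  have h1 := h.nablaJAt_self x (u + v)
  rw [nablaJAt_add_left, nablaJAt_add_right, nablaJAt_add_right, h.nablaJAt_self,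
    h.nablaJAt_self, zero_add, add_zero] at h1
  exact eq_neg_of_add_eq_zero_left h1

/-- For totally skew `∇σ` the three cyclic terms of `dσ` are equal. -/
theorem d_σ_apply (h : S.IsNearlyKahler) (x : M) (u v w : TangentSpace (𝓡 n) x) :
    S.σ.d x ![u, v, w] = 3 * S.gLin x (S.nablaJAt x u v) w := by
  have e1 := S.nablaJAt_skew x v w u
  have e2 := S.nablaJAt_skew x w u v
  rw [S.d_σ_apply, e1, e2, h.nablaJAt_swap x v u, h.nablaJAt_swap x w v, map_neg, map_neg,
    LinearMap.neg_apply, LinearMap.neg_apply, neg_neg, neg_neg, e1, h.nablaJAt_swap x v u, map_neg,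
    LinearMap.neg_apply]
  ring

theorem third_d_σ_apply (h : S.IsNearlyKahler) (x : M) (u v w : TangentSpace (𝓡 n) x) :
    ((3 : ℝ)⁻¹ • S.σ.d) x ![u, v, w] = S.gLin x (S.nablaJAt x u v) w := by
  have h1 : ((3 : ℝ)⁻¹ • S.σ.d) x ![u, v, w] = 3⁻¹ * S.σ.d x ![u, v, w] := rfl
  rw [h1, h.d_σ_apply]
  ring

theorem isTypePair (h : S.IsNearlyKahler) :
    S.IsTypePair ((3 : ℝ)⁻¹ • S.σ.d) (S.conjForm ((3 : ℝ)⁻¹ • S.σ.d)) := by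
  refine isTypePair_conjForm fun x u v w ↦ ?_
  rw [h.third_d_σ_apply, h.third_d_σ_apply]
  have h1 := S.nablaJAt_J x u v
  have h2 := S.nablaJAt_J x v u
  have h3 : S.nablaJAt x (S.jLin x u) v = -S.nablaJAt x v (S.jLin x u) := h.nablaJAt_swap x _ _
  change S.gLin x (S.nablaJAt x (S.jLin x u) v) w = S.gLin x (S.nablaJAt x u (S.jLin x v)) w
  rw [h3, h1, h2, h.nablaJAt_swap x u v, map_neg (S.jLin x)]

end IsNearlyKahler

end AlmostHermitian

end NearlyKahler

/-! ### Constancy of the norm and the structure equations -/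

section ConstancyOfTheNorm

theorem DForm.IsSmooth.ofRealRe_ofRealIm {n : ℕ} {M : Type*} [TopologicalSpace M]
    [ChartedSpace (EuclideanSpace ℝ (Fin n)) M] {k : ℕ} {A B : DForm n M k ℝ} (hA : A.IsSmooth)
    (hB : B.IsSmooth) : DForm.IsSmooth (n := n) (M := M) (k := k) fun x ↦
      Complex.ofRealCLM.compContinuousAlternatingMap (A x) +
        Complex.I • Complex.ofRealCLM.compContinuousAlternatingMap (B x) := fun x ↦
  contDiffOn_continuousAlternatingMap_of_apply fun v ↦
    (Complex.ofRealCLM.contDiff.comp_contDiffOn (hA.contDiffOn_apply x v)).add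
      ((Complex.ofRealCLM.contDiff.comp_contDiffOn (hB.contDiffOn_apply x v)).const_smul Complex.I)

variable {M : Type*} [TopologicalSpace M] [ChartedSpace (EuclideanSpace ℝ (Fin 6)) M]
  [IsManifold (𝓡 6) ∞ M] {S : AlmostHermitian 6 M}

namespace AlmostHermitian

/-- If `-2 ρ σ ∧ σ` is exact and `dσ` is of type `(3, 0) + (0, 3)`, then `dρ = 0`. -/
theorem hasMFDerivAt_zero_of_d_eq {A B : DForm 6 M 3 ℝ} (hA : S.IsTypePair A B) (hB : B.IsSmooth)
    (hσ : S.σ.d = (3 : ℝ) • A) {ρ : M → ℝ}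
    (h : ∀ (x : M) (u v w z : TangentSpace (𝓡 6) x), B.d x ![u, v, w, z] =
      -4 * ρ x * (S.σ x ![u, v] * S.σ x ![w, z] - S.σ x ![u, w] * S.σ x ![v, z]
        + S.σ x ![u, z] * S.σ x ![v, w])) (x : M) :
    HasMFDerivAt (𝓡 6) 𝓘(ℝ, ℝ) ρ x 0 := by
  set p := extChartAt (𝓡 6) x x with hp
  have hloc : ∀ᶠ z in nhds p, ∀ a b c d, B.d.inChart x z ![a, b, c, d] =
      -4 * ρ ((extChartAt (𝓡 6) x).symm z) * (S.σ.inChart x z ![a, b] * S.σ.inChart x z ![c, d]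
        - S.σ.inChart x z ![a, c] * S.σ.inChart x z ![b, d]
        + S.σ.inChart x z ![a, d] * S.σ.inChart x z ![b, c]) := by
    filter_upwards [(isOpen_extChartAt_target (I := 𝓡 6) x).mem_nhds (mem_extChartAt_target x)]
      with z hz a b c d
    set y := (extChartAt (𝓡 6) x).symm z with hy
    have h2 : ∀ a b, S.σ.inChart x z ![a, b] = S.σ y ![coordField x a y, coordField x b y] := by
      intro a b
      rw [DForm.inChart_apply _ hz]
      refine congrArg (S.σ y) (funext fun i ↦ ?_)
      fin_cases i <;> rfl
    have h4 : B.d.inChart x z ![a, b, c, d] =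
        B.d y ![coordField x a y, coordField x b y, coordField x c y, coordField x d y] := by
      rw [DForm.inChart_apply _ hz]
      refine congrArg (B.d y) (funext fun i ↦ ?_)
      fin_cases i <;> rfl
    rw [h4, h2, h2, h2, h2, h2, h2, h]
  have hs := S.isSmooth_σ.differentiableAt x
  have hβ := hB.d.differentiableAt x
  have hH := S.isHermitian x
  -- A unit vector is completed, as `e 2`, to a unitary frame. The pairs `(e 0, J e 0)` and `(e 1, J
  -- e 1)` are then dual for `σ` and orthogonal to it, as `extDeriv_mul_wedge_self` requires.
  have key : ∀ u : TangentSpace (𝓡 6) x, S.gLin x u u = 1 →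
      DifferentiableAt ℝ (fun z ↦ ρ ((extChartAt (𝓡 6) x).symm z)) p ∧
      fderiv ℝ (fun z ↦ ρ ((extChartAt (𝓡 6) x).symm z)) p u = 0 := by
    intro u hu
    obtain ⟨e, he, rfl⟩ := hH.exists_isUnitaryFrame (finrank_tangentSpace x) hu
    have q : ∀ i j, S.gLin x (S.jLin x (e i)) (e j) = 0 := fun i j ↦ by
      rw [hH.g_J_left, he.inner_J_eq, neg_zero]
    have hσx : ∀ a b : TangentSpace (𝓡 6) x, S.σ.inChart x p ![a, b] = S.gLin x (S.jLin x a) b :=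
      fun a b ↦ S.σ.inChart_self_apply x ![a, b]
    have s1 : ∀ i j, S.σ.inChart x p ![e i, e j] = 0 := fun i j ↦ by rw [hσx, q]
    have s2 : ∀ i j, S.σ.inChart x p ![e i, S.jLin x (e j)] = if i = j then 1 else 0 :=
      fun i j ↦ by rw [hσx, hH.g_J_J, he.inner_eq]
    have s3 : ∀ i j, S.σ.inChart x p ![S.jLin x (e i), e j] = if i = j then -1 else 0 :=
      fun i j ↦ by
        rw [hσx, hH.J_J, map_neg, LinearMap.neg_apply, he.inner_eq]
        split <;> simp
    have s4 : ∀ i j, S.σ.inChart x p ![S.jLin x (e i), S.jLin x (e j)] = 0 := fun i j ↦ by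
      rw [hσx, hH.J_J, map_neg, LinearMap.neg_apply, he.inner_J_eq, neg_zero]
    have hr : DifferentiableAt ℝ (fun z ↦ ρ ((extChartAt (𝓡 6) x).symm z)) p := by
      refine differentiableAt_of_eq_mul_wedge_self hs hβ (a := e 0) (b := S.jLin x (e 0))
        (c := e 1) (d := S.jLin x (e 1)) (hloc.mono fun z hz ↦ hz _ _ _ _) ?_
      rw [s2, s2, s1, s4, s2, s3]
      simp
    refine ⟨hr, ?_⟩
    have hd := extDeriv_mul_wedge_self hs hβ hr hloc (X := e 2) (a := e 0) (b := S.jLin x (e 0))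
      (c := e 1) (d := S.jLin x (e 1)) (s1 _ _) (by rw [s2]; simp) (s1 _ _) (by rw [s2]; simp)
      (by rw [s2]; simp) (by rw [s2]; simp) (s1 _ _) (s4 _ _) (by rw [s2]; simp)
      (by rw [s3]; simp)
    -- Together with `d(dB) = 0`, the vanishing of `dσ(e₂, eᵢ, J eᵢ)` leaves only the derivative of
    -- `ρ` along `e 2`.
    have h0 : ∀ i, extDeriv (S.σ.inChart x) p ![e 2, e i, S.jLin x (e i)] = 0 := by
      intro i
      refine (S.σ.d_apply x _).symm.trans ?_
      rw [hσ]
      have h1 := (hA.isRealType30 x).apply_J_self (e 2) (e i)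
      rw [DForm.trilinearAt_apply] at h1
      exact (congrArg (3 * ·) h1).trans (mul_zero 3)
    have h1 : extDeriv (B.d.inChart x) p ![e 2, e 0, S.jLin x (e 0), e 1, S.jLin x (e 1)] = 0 := by
      refine (B.d.d_apply x _).symm.trans ?_
      rw [hB.d_d]
      rfl
    have h2 := (congrArg₂ (fun s t : ℝ ↦ -4 * (fderiv ℝ (fun z ↦ ρ ((extChartAt (𝓡 6) x).symm z)) p
      (e 2) + ρ ((extChartAt (𝓡 6) x).symm p) * (s + t))) (h0 0) (h0 1)).symm.trans
        (hd.symm.trans h1)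
    simpa using h2
  have hzero : ∀ X : TangentSpace (𝓡 6) x,
      fderiv ℝ (fun z ↦ ρ ((extChartAt (𝓡 6) x).symm z)) p X = 0 := by
    intro X
    by_cases hX : X = 0
    · rw [hX]
      exact map_zero (fderiv ℝ (fun z ↦ ρ ((extChartAt (𝓡 6) x).symm z)) p)
    have hpos := hH.pos X hX
    have hne := (Real.sqrt_pos.2 hpos).ne'
    have hu : S.gLin x ((Real.sqrt (S.gLin x X X))⁻¹ • X) ((Real.sqrt (S.gLin x X X))⁻¹ • X) = 1 := by
      rw [map_smul, map_smul, LinearMap.smul_apply, smul_eq_mul, smul_eq_mul]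
      have h1 := Real.mul_self_sqrt hpos.le
      field_simp
      rw [sq, h1]
    have h1 := (key _ hu).2
    have h2 := (map_smul (fderiv ℝ (fun z ↦ ρ ((extChartAt (𝓡 6) x).symm z)) p)
      (Real.sqrt (S.gLin x X X))⁻¹ X).symm.trans h1
    exact (smul_eq_zero.1 h2).resolve_left (inv_ne_zero hne)
  have hdiff : DifferentiableAt ℝ (fun z ↦ ρ ((extChartAt (𝓡 6) x).symm z)) p := by
    obtain ⟨e, he⟩ := S.exists_unitaryFrame x
    exact (key (e 0) (by rw [he.inner_eq]; simp)).1
  have hf := hdiff.hasFDerivAt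
  have hf0 : fderiv ℝ (fun z ↦ ρ ((extChartAt (𝓡 6) x).symm z)) p = 0 :=
    ContinuousLinearMap.ext hzero
  rw [hf0] at hf
  exact hasMFDerivAt_of_hasFDerivAt_extChartAt hf

theorem IsNearlyKahler.exists_structure_equations [T2Space M] [PreconnectedSpace M]
    (h : S.IsNearlyKahler) : ∃ (μ : ℝ) (ψ : DForm 6 M 3 ℂ), μ ≠ 0 ∧ ψ.IsSmooth ∧ S.IsType30 ψ ∧
      S.σ.d = (3 * μ) • ψ.re ∧ ψ.im.d = (-2 * μ) • S.σ.wedge S.σ := by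
  set A : DForm 6 M 3 ℝ := (3 : ℝ)⁻¹ • S.σ.d with hAdef
  set B : DForm 6 M 3 ℝ := S.conjForm A with hBdef
  have hAB : S.IsTypePair A B := h.isTypePair
  have hA : A.IsSmooth := S.isSmooth_σ.d.smul _
  have hB : B.IsSmooth := hAB.isSmooth hA
  have hσ : S.σ.d = (3 : ℝ) • A := by rw [hAdef, smul_smul]; norm_num
  have hdA : A.d = 0 := by rw [hAdef, DForm.d_smul, S.isSmooth_σ.d_d, smul_zero]
  -- The frames are chosen pointwise, without continuity. Differentiability of `ρ` is obtained later
  -- from the equation for `dB`.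
  choose e he using S.exists_unitaryFrame
  set ρ : M → ℝ := fun x ↦ normSqInFrame (S.jLin x) (A.trilinearAt x) (e x) with hρ
  have hdB : ∀ (x : M) (u v w z : TangentSpace (𝓡 6) x), B.d x ![u, v, w, z] =
      -4 * ρ x * (S.σ x ![u, v] * S.σ x ![w, z] - S.σ x ![u, w] * S.σ x ![v, z]
        + S.σ x ![u, z] * S.σ x ![v, w]) := fun x u v w z ↦
    (hAB.isRealType30 x).eq_smul_wedge (S.isHermitian x) (he x) (finrank_tangentSpace x)
      (T := S.nablaJAt x) (fun u v w ↦ (h.third_d_σ_apply x u v w).symm)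
      (β := fun u v w z ↦ B.d x ![u, v, w, z])
      (ContinuousAlternatingMap.four_neg_left (E := EuclideanSpace ℝ (Fin 6)) (B.d x))
      (ContinuousAlternatingMap.four_swap_left (E := EuclideanSpace ℝ (Fin 6)) (B.d x))
      (ContinuousAlternatingMap.four_swap_mid (E := EuclideanSpace ℝ (Fin 6)) (B.d x))
      (hAB.d_sub_d hA hB hdA x) u v w z
  have hconst := eq_of_hasMFDerivAt_zero (hasMFDerivAt_zero_of_d_eq hAB hB hσ hdB)
  obtain ⟨X, Y, -, hY, x₀, hx₀⟩ := h.2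
  -- A zero of `ρ` would make `A`, and hence `∇J`, vanish at `x₀`, where it is nonzero by
  -- strictness.
  have hpos : 0 < ρ x₀ := by
    refine lt_of_le_of_ne (by simp only [hρ, normSqInFrame]; positivity) fun h0 ↦ hx₀ ?_
    rw [S.nablaJ_apply hY]
    refine (S.isHermitian x₀).eq_of_inner_eq fun w ↦ ?_
    rw [← h.third_d_σ_apply, map_zero, LinearMap.zero_apply]
    exact (hAB.isRealType30 x₀).eq_zero_of_normSqInFrame (S.isHermitian x₀) (finrank_tangentSpace x₀)
      (he x₀) h0.symm _ _ _
  -- Scaling `A` and `B` by `μ⁻¹` turns `dσ = 3A` and `dB = -2ρ σ ∧ σ` into equations with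
  -- coefficients `3μ` and `-2ρ/μ`; the latter is `-2μ` exactly when `μ² = ρ`.
  set μ := Real.sqrt (ρ x₀) with hμ
  have hμ0 : μ ≠ 0 := (Real.sqrt_pos.2 hpos).ne'
  have hμ2 : μ * μ = ρ x₀ := Real.mul_self_sqrt hpos.le
  let ψ : DForm 6 M 3 ℂ := fun x ↦
    Complex.ofRealCLM.compContinuousAlternatingMap ((μ⁻¹ • A) x) +
      Complex.I • Complex.ofRealCLM.compContinuousAlternatingMap ((μ⁻¹ • B) x)
  have hψ : ∀ (x : M) (v : Fin 3 → TangentSpace (𝓡 6) x),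
      ψ x v = ((μ⁻¹ * A x v : ℝ) : ℂ) + Complex.I * ((μ⁻¹ * B x v : ℝ) : ℂ) := fun _ _ ↦ rfl
  have hre : ψ.re = μ⁻¹ • A := by
    funext x
    ext v
    have h1 : ψ.re x v = (ψ x v).re := rfl
    have h2 : (μ⁻¹ • A) x v = μ⁻¹ * A x v := rfl
    rw [h1, h2, hψ]
    simp
  have him : ψ.im = μ⁻¹ • B := by
    funext x
    ext v
    have h1 : ψ.im x v = (ψ x v).im := rfl
    have h2 : (μ⁻¹ • B) x v = μ⁻¹ * B x v := rfl
    rw [h1, h2, hψ]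
    simp
  refine ⟨μ, ψ, hμ0, (hA.smul _).ofRealRe_ofRealIm (hB.smul _), fun x u v w ↦ ?_, ?_, ?_⟩
  · rw [hψ, hψ, hAB.im_J, hAB.re_J]
    apply Complex.ext <;> simp
  · rw [hre, smul_smul, hσ]
    congr 1
    field_simp
  · rw [him, DForm.d_smul]
    funext x
    ext v
    have hv : v = ![v 0, v 1, v 2, v 3] := by ext i; fin_cases i <;> rfl
    have h1 : (μ⁻¹ • B.d) x v = μ⁻¹ * B.d x v := rfl
    have h2 : ((-2 * μ) • S.σ.wedge S.σ) x v = -2 * μ * (S.σ.wedge S.σ) x v := rfl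
    rw [h1, h2, hv, DForm.wedge_self_apply, hdB, hconst x x₀, ← hμ2]
    field_simp
    ring

end AlmostHermitian

end ConstancyOfTheNorm

/-- A connected almost Hermitian six-manifold is (strict) nearly Kähler if and only if there are a
nonzero constant `μ` and a smooth complex `(3, 0)`-form `ψ = ψ₊ + i ψ₋` with `dσ = 3 μ ψ₊` and
`dψ₋ = -2 μ σ ∧ σ`; in that case `(σ, ψ)` is an `SU(3)`-structure. -/
theorem mainTheorem2 (M : Type*) [TopologicalSpace M] [T2Space M] [SecondCountableTopology M]
    [ConnectedSpace M] [ChartedSpace (EuclideanSpace ℝ (Fin 6)) M] [IsManifold (𝓡 6) ∞ M]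
    (S : AlmostHermitian 6 M) :
    (S.IsNearlyKahler ↔ ∃ (μ : ℝ) (ψ : DForm 6 M 3 ℂ), μ ≠ 0 ∧ ψ.IsSmooth ∧ S.IsType30 ψ ∧
      S.σ.d = (3 * μ) • ψ.re ∧ ψ.im.d = (-2 * μ) • S.σ.wedge S.σ) ∧
    (∀ (μ : ℝ) (ψ : DForm 6 M 3 ℂ), μ ≠ 0 → ψ.IsSmooth → S.IsType30 ψ →
      S.σ.d = (3 * μ) • ψ.re → ψ.im.d = (-2 * μ) • S.σ.wedge S.σ → S.IsSU3Structure ψ) :=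
  ⟨⟨fun h ↦ h.exists_structure_equations, fun ⟨_, _, hμ, hψ, h, hσ, hd⟩ ↦
    AlmostHermitian.isNearlyKahler_of_structure_equations hψ h hμ hσ hd⟩,
    fun _ _ hμ hψ h hσ hd ↦ AlmostHermitian.isSU3Structure_of_structure_equations hψ h hμ hσ hd⟩
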